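/- Let $F$ be a field, let $L_1$ and $L_2$ be finite-dimensional Lie algebras over $F$, and let $N_1$ and $N_2$ be ideals of $L_1$ and $L_2$. Let $L_1 * L_2$ denote the free product (coproduct) of Lie algebras, and assume that $N_1 * N_2$, that is, the subalgebra of $L_1 * L_2$ generated by $N_1$ and $N_2$ (the image of the canonical map from the free product of $N_1$ and $N_2$), is an ideal of $L_1 * L_2$. For a Lie algebra $L$ with an ideal $N$, the nonabelian tensor product $L \otimes N$ is the Lie algebra over $F$ generated by the symbols $l \otimes n$ ($l \in L$, $n \in N$) with the defining relations that $l \otimes n$ is $F$-bilinear in $(l,n)$ and that, for all $l, l' \in L$ and $n, n' \in N$, \[ [l,l'] \otimes n = l \otimes [l',n] - l' \otimes [l,n], \quad l \otimes [n,n'] = [n',l] \otimes n - [n,l] \otimes n', \quad [l \otimes n, l' \otimes n'] = -[n,l] \otimes [l',n']. \] Let $J_2(L,N)$ be the kernel of the homomorphism of Lie algebras $L \otimes N \to [L,N]$, $l \otimes n \mapsto [l,n]$. Then the homomorphism $J_2(L_1 * L_2, N_1 * N_2) \to J_2(L_1 \oplus L_2, N_1 \oplus N_2)$ induced by the canonical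 epimorphism $L_1 * L_2 \to L_1 \oplus L_2$ is injective, its image is an ideal, and, with $J_2(L_1 * L_2, N_1 * N_2)$ identified with this image, there is an isomorphism of Lie algebras \[ \frac{J_2(L_1 \oplus L_2, N_1 \oplus N_2)}{J_2(L_1 * L_2, N_1 * N_2)} \simeq \frac{N_1}{[N_1,L_1]} \otimes \frac{N_2}{[N_2,L_2]}, \] where the right-hand side is the nonabelian tensor product of two abelian Lie algebras acting trivially on each other, that is, the usual tensor product over $F$ with zero bracket. -/

import Mathlib

open scoped TensorProduct

universe u v w

noncomputable section

/-! ### Lie algebras given by generators and relations -/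

section Presented

variable {F : Type u} [CommRing F] {X : Type v}

/-- The ideal of the free Lie algebra on `X` generated by all `a - b` with `r a b`. -/
def lieRelIdeal (r : FreeLieAlgebra F X → FreeLieAlgebra F X → Prop) :
    LieIdeal F (FreeLieAlgebra F X) :=
  LieSubmodule.lieSpan F (FreeLieAlgebra F X) {z | ∃ a b, r a b ∧ z = a - b}

/-- The Lie algebra with generators `X` and defining relations `a = b` for `r a b`. -/
abbrev PresentedLie (r : FreeLieAlgebra F X → FreeLieAlgebra F X → Prop) : Type (max u v) :=
  FreeLieAlgebra F X ⧸ lieRelIdeal r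

namespace PresentedLie

variable (r : FreeLieAlgebra F X → FreeLieAlgebra F X → Prop)

/-- The quotient map. -/
def mk : FreeLieAlgebra F X →ₗ⁅F⁆ PresentedLie r :=
  { (LieSubmodule.Quotient.mk' (lieRelIdeal r) :
      FreeLieAlgebra F X →ₗ[F] FreeLieAlgebra F X ⧸ lieRelIdeal r) with
    map_lie' := fun {_ _} => rfl }

/-- The class of a generator. -/
def of (x : X) : PresentedLie r := mk r (FreeLieAlgebra.of F x)

variable {r}

theorem mk_surjective : Function.Surjective (mk r) := Quot.mk_surjective

theorem mk_eq {a b : FreeLieAlgebra F X} (h : r a b) : mk r a = mk r b := by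
  rw [← sub_eq_zero, ← map_sub]
  exact (LieSubmodule.Quotient.mk_eq_zero (N := lieRelIdeal r)).2
    (LieSubmodule.subset_lieSpan ⟨a, b, h, rfl⟩)

variable {M : Type w} [LieRing M] [LieAlgebra F M]

theorem lieRelIdeal_le_ker (f : X → M)
    (hf : ∀ a b, r a b → FreeLieAlgebra.lift F f a = FreeLieAlgebra.lift F f b) :
    lieRelIdeal r ≤ (FreeLieAlgebra.lift F f).ker := by
  refine LieSubmodule.lieSpan_le.2 ?_
  rintro _ ⟨a, b, h, rfl⟩
  simp [hf a b h]

/-- The universal property: a map on generators which respects the relations extends to a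
homomorphism of Lie algebras. -/
def lift (f : X → M)
    (hf : ∀ a b, r a b → FreeLieAlgebra.lift F f a = FreeLieAlgebra.lift F f b) :
    PresentedLie r →ₗ⁅F⁆ M :=
  { (lieRelIdeal r).toSubmodule.liftQ (FreeLieAlgebra.lift F f : FreeLieAlgebra F X →ₗ[F] M)
      (fun _ hx => LieHom.mem_ker.1 (lieRelIdeal_le_ker f hf hx)) with
    map_lie' := by
      intro x y
      obtain ⟨x, rfl⟩ := mk_surjective x
      obtain ⟨y, rfl⟩ := mk_surjective y
      exact LieHom.map_lie (FreeLieAlgebra.lift F f) x y }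

@[simp]
theorem lift_of (f : X → M)
    (hf : ∀ a b, r a b → FreeLieAlgebra.lift F f a = FreeLieAlgebra.lift F f b) (x : X) :
    lift f hf (of r x) = f x :=
  FreeLieAlgebra.lift_of_apply f x

theorem hom_ext {f g : PresentedLie r →ₗ⁅F⁆ M} (h : ∀ x, f (of r x) = g (of r x)) : f = g := by
  have h' : f.comp (mk r) = g.comp (mk r) := FreeLieAlgebra.hom_ext h
  ext x
  obtain ⟨x, rfl⟩ := mk_surjective x
  exact LieHom.congr_fun h' x

end PresentedLie

end Presented

/-! ### The free product of two Lie algebras -/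

section FreeProduct

variable (F : Type u) [CommRing F]
variable (L₁ : Type v) [LieRing L₁] [LieAlgebra F L₁] (L₂ : Type w) [LieRing L₂] [LieAlgebra F L₂]

/-- The generator of the free Lie algebra on the disjoint union of `L₁` and `L₂` given by
`x : L₁`. -/
abbrev lieGenL (x : L₁) : FreeLieAlgebra F (L₁ ⊕ L₂) := FreeLieAlgebra.of F (Sum.inl x)

/-- The generator of the free Lie algebra on the disjoint union of `L₁` and `L₂` given by
`x : L₂`. -/
abbrev lieGenR (x : L₂) : FreeLieAlgebra F (L₁ ⊕ L₂) := FreeLieAlgebra.of F (Sum.inr x)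

/-- The relations which make the maps from `L₁` and `L₂` to the free Lie algebra on the disjoint
union of `L₁` and `L₂` homomorphisms of Lie algebras. -/
inductive LieFreeProductRel : FreeLieAlgebra F (L₁ ⊕ L₂) → FreeLieAlgebra F (L₁ ⊕ L₂) → Prop
  | add_left (x y : L₁) :
      LieFreeProductRel (lieGenL F L₁ L₂ (x + y)) (lieGenL F L₁ L₂ x + lieGenL F L₁ L₂ y)
  | smul_left (c : F) (x : L₁) :
      LieFreeProductRel (lieGenL F L₁ L₂ (c • x)) (c • lieGenL F L₁ L₂ x)
  | lie_left (x y : L₁) :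
      LieFreeProductRel (lieGenL F L₁ L₂ ⁅x, y⁆) ⁅lieGenL F L₁ L₂ x, lieGenL F L₁ L₂ y⁆
  | add_right (x y : L₂) :
      LieFreeProductRel (lieGenR F L₁ L₂ (x + y)) (lieGenR F L₁ L₂ x + lieGenR F L₁ L₂ y)
  | smul_right (c : F) (x : L₂) :
      LieFreeProductRel (lieGenR F L₁ L₂ (c • x)) (c • lieGenR F L₁ L₂ x)
  | lie_right (x y : L₂) :
      LieFreeProductRel (lieGenR F L₁ L₂ ⁅x, y⁆) ⁅lieGenR F L₁ L₂ x, lieGenR F L₁ L₂ y⁆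

/-- The free product (coproduct) `L₁ * L₂` of two Lie algebras. -/
abbrev LieFreeProduct : Type (max u v w) := PresentedLie (LieFreeProductRel F L₁ L₂)

namespace LieFreeProduct

/-- The canonical homomorphism `L₁ → L₁ * L₂`. -/
def inl : L₁ →ₗ⁅F⁆ LieFreeProduct F L₁ L₂ where
  toFun x := PresentedLie.of _ (.inl x)
  map_add' x y := (PresentedLie.mk_eq (.add_left x y)).trans (map_add _ _ _)
  map_smul' c x := (PresentedLie.mk_eq (.smul_left c x)).trans (map_smul _ _ _)
  map_lie' {x y} := (PresentedLie.mk_eq (.lie_left x y)).trans (LieHom.map_lie _ _ _)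

/-- The canonical homomorphism `L₂ → L₁ * L₂`. -/
def inr : L₂ →ₗ⁅F⁆ LieFreeProduct F L₁ L₂ where
  toFun x := PresentedLie.of _ (.inr x)
  map_add' x y := (PresentedLie.mk_eq (.add_right x y)).trans (map_add _ _ _)
  map_smul' c x := (PresentedLie.mk_eq (.smul_right c x)).trans (map_smul _ _ _)
  map_lie' {x y} := (PresentedLie.mk_eq (.lie_right x y)).trans (LieHom.map_lie _ _ _)

variable {F L₁ L₂} {M : Type*} [LieRing M] [LieAlgebra F M]

/-- The homomorphism `L₁ * L₂ → M` with given restrictions to `L₁` and `L₂`. -/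
def lift (f : L₁ →ₗ⁅F⁆ M) (g : L₂ →ₗ⁅F⁆ M) : LieFreeProduct F L₁ L₂ →ₗ⁅F⁆ M :=
  PresentedLie.lift (Sum.elim f g) (by rintro _ _ (_ | _ | _ | _ | _ | _) <;> simp)

@[simp]
theorem lift_inl (f : L₁ →ₗ⁅F⁆ M) (g : L₂ →ₗ⁅F⁆ M) (x : L₁) :
    lift f g (inl F L₁ L₂ x) = f x :=
  PresentedLie.lift_of _ _ _

@[simp]
theorem lift_inr (f : L₁ →ₗ⁅F⁆ M) (g : L₂ →ₗ⁅F⁆ M) (x : L₂) :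
    lift f g (inr F L₁ L₂ x) = g x :=
  PresentedLie.lift_of _ _ _

theorem hom_ext {f g : LieFreeProduct F L₁ L₂ →ₗ⁅F⁆ M}
    (h₁ : ∀ x, f (inl F L₁ L₂ x) = g (inl F L₁ L₂ x))
    (h₂ : ∀ x, f (inr F L₁ L₂ x) = g (inr F L₁ L₂ x)) : f = g :=
  PresentedLie.hom_ext (by rintro (x | x); exacts [h₁ x, h₂ x])

/-- The canonical homomorphism `N₁ * N₂ → L₁ * L₂`, for ideals `N₁` of `L₁` and `N₂` of `L₂`. -/
def inclusion (N₁ : LieIdeal F L₁) (N₂ : LieIdeal F L₂) :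
    LieFreeProduct F N₁ N₂ →ₗ⁅F⁆ LieFreeProduct F L₁ L₂ :=
  lift ((inl F L₁ L₂).comp N₁.incl) ((inr F L₁ L₂).comp N₂.incl)

variable (F L₁ L₂) in
/-- The canonical epimorphism `L₁ * L₂ → L₁ ⊕ L₂`. -/
def toProd : LieFreeProduct F L₁ L₂ →ₗ⁅F⁆ L₁ × L₂ :=
  lift (LieHom.inl F L₁ L₂) (LieHom.inr F L₁ L₂)

end LieFreeProduct

variable {F L₁ L₂}

/-- The ideal `N₁ ⊕ N₂` of `L₁ ⊕ L₂`. -/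
def lieIdealProd (N₁ : LieIdeal F L₁) (N₂ : LieIdeal F L₂) : LieIdeal F (L₁ × L₂) :=
  { N₁.toSubmodule.prod N₂.toSubmodule with
    lie_mem := fun {_ _} h => ⟨N₁.lie_mem h.1, N₂.lie_mem h.2⟩ }

theorem LieFreeProduct.toProd_mem {N₁ : LieIdeal F L₁} {N₂ : LieIdeal F L₂}
    {N : LieIdeal F (LieFreeProduct F L₁ L₂)}
    (hN : N.toLieSubalgebra = (LieFreeProduct.inclusion N₁ N₂).range) :
    ∀ x ∈ N, LieFreeProduct.toProd F L₁ L₂ x ∈ lieIdealProd N₁ N₂ := by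
  intro x hx
  have hx' : x ∈ N.toLieSubalgebra := hx
  rw [hN] at hx'
  obtain ⟨y, rfl⟩ := hx'
  have key : (toProd F L₁ L₂).comp (inclusion N₁ N₂) =
      (lieIdealProd N₁ N₂).incl.comp (lift
        ⟨((LinearMap.inl F L₁ L₂) ∘ₗ N₁.toSubmodule.subtype).codRestrict
          (lieIdealProd N₁ N₂).toSubmodule (fun n => ⟨n.2, N₂.zero_mem⟩), by
            intro a b; apply Subtype.ext; exact Prod.ext rfl (lie_zero (0 : L₂)).symm⟩
        ⟨((LinearMap.inr F L₁ L₂) ∘ₗ N₂.toSubmodule.subtype).codRestrict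
          (lieIdealProd N₁ N₂).toSubmodule (fun n => ⟨N₁.zero_mem, n.2⟩), by
            intro a b; apply Subtype.ext; exact Prod.ext (lie_zero (0 : L₁)).symm rfl⟩) := by
    apply hom_ext
    · intro x
      simp [toProd, inclusion]
      rfl
    · intro x
      simp [toProd, inclusion]
      rfl
  have := LieHom.congr_fun key y
  change toProd F L₁ L₂ (inclusion N₁ N₂ y) ∈ _
  change toProd F L₁ L₂ (inclusion N₁ N₂ y) = _ at this
  rw [this]
  exact Subtype.property _

end FreeProduct

/-! ### The nonabelian tensor product -/

section Tensor

variable {F : Type u} [CommRing F]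
variable {L : Type v} [LieRing L] [LieAlgebra F L] {N : Type w} [LieRing N] [LieAlgebra F N]

open FreeLieAlgebra (of) in
/-- The defining relations of the nonabelian tensor product of two Lie algebras `L` and `N` which
act on each other by derivations; here `a l n` is `ˡn`, `b n l` is `ⁿl`, and the generator
`(l, n)` stands for `l ⊗ n`. -/
inductive LieTensorRel (a : L →ₗ⁅F⁆ LieDerivation F N N) (b : N →ₗ⁅F⁆ LieDerivation F L L) :
    FreeLieAlgebra F (L × N) → FreeLieAlgebra F (L × N) → Prop
  | smul_left (c : F) (l : L) (n : N) : LieTensorRel a b (of F (c • l, n)) (c • of F (l, n))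
  | smul_right (c : F) (l : L) (n : N) : LieTensorRel a b (of F (l, c • n)) (c • of F (l, n))
  | add_left (l l' : L) (n : N) : LieTensorRel a b (of F (l + l', n)) (of F (l, n) + of F (l', n))
  | add_right (l : L) (n n' : N) : LieTensorRel a b (of F (l, n + n')) (of F (l, n) + of F (l, n'))
  | lie_left (l l' : L) (n : N) :
      LieTensorRel a b (of F (⁅l, l'⁆, n)) (of F (l, a l' n) - of F (l', a l n))
  | lie_right (l : L) (n n' : N) :
      LieTensorRel a b (of F (l, ⁅n, n'⁆)) (of F (b n' l, n) - of F (b n l, n'))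
  | lie_lie (l l' : L) (n n' : N) :
      LieTensorRel a b ⁅of F (l, n), of F (l', n')⁆ (-of F (b n l, a l' n'))

/-- The nonabelian tensor product `L ⊗ N` with respect to the actions `a` of `L` on `N` and `b` of
`N` on `L`. -/
abbrev LieTensor (a : L →ₗ⁅F⁆ LieDerivation F N N) (b : N →ₗ⁅F⁆ LieDerivation F L L) :
    Type (max u v w) :=
  PresentedLie (LieTensorRel a b)

/-- The element `l ⊗ n`. -/
def LieTensor.tmul (a : L →ₗ⁅F⁆ LieDerivation F N N) (b : N →ₗ⁅F⁆ LieDerivation F L L)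
    (l : L) (n : N) : LieTensor a b :=
  PresentedLie.of _ (l, n)

namespace LieTensor

variable (a : L →ₗ⁅F⁆ LieDerivation F N N) (b : N →ₗ⁅F⁆ LieDerivation F L L)

theorem smul_tmul (c : F) (l : L) (n : N) : tmul a b (c • l) n = c • tmul a b l n :=
  (PresentedLie.mk_eq (LieTensorRel.smul_left c l n)).trans (map_smul _ _ _)

theorem tmul_smul (c : F) (l : L) (n : N) : tmul a b l (c • n) = c • tmul a b l n :=
  (PresentedLie.mk_eq (LieTensorRel.smul_right c l n)).trans (map_smul _ _ _)

theorem add_tmul (l l' : L) (n : N) : tmul a b (l + l') n = tmul a b l n + tmul a b l' n :=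
  (PresentedLie.mk_eq (LieTensorRel.add_left l l' n)).trans (map_add _ _ _)

theorem tmul_add (l : L) (n n' : N) : tmul a b l (n + n') = tmul a b l n + tmul a b l n' :=
  (PresentedLie.mk_eq (LieTensorRel.add_right l n n')).trans (map_add _ _ _)

theorem lie_tmul (l l' : L) (n : N) :
    tmul a b ⁅l, l'⁆ n = tmul a b l (a l' n) - tmul a b l' (a l n) :=
  (PresentedLie.mk_eq (LieTensorRel.lie_left l l' n)).trans (map_sub _ _ _)

theorem tmul_lie (l : L) (n n' : N) :
    tmul a b l ⁅n, n'⁆ = tmul a b (b n' l) n - tmul a b (b n l) n' :=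
  (PresentedLie.mk_eq (LieTensorRel.lie_right l n n')).trans (map_sub _ _ _)

theorem lie_tmul_tmul (l l' : L) (n n' : N) :
    ⁅tmul a b l n, tmul a b l' n'⁆ = -tmul a b (b n l) (a l' n') :=
  ((LieHom.map_lie _ _ _).symm.trans (PresentedLie.mk_eq (LieTensorRel.lie_lie l l' n n'))).trans
    (map_neg _ _)

end LieTensor

end Tensor

/-! ### The nonabelian tensor product of a pair, and `J₂` -/

section Pair

variable {F : Type u} [CommRing F]
variable {L : Type v} [LieRing L] [LieAlgebra F L] {L' : Type w} [LieRing L'] [LieAlgebra F L']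

/-- The action of `L` on its ideal `N` by Lie multiplication, `ˡn = [l, n]`. -/
def LieIdeal.actLeft (N : LieIdeal F L) : L →ₗ⁅F⁆ LieDerivation F N N where
  toFun l :=
    { toFun := fun n => ⁅l, n⁆
      map_add' := fun x y => lie_add l x y
      map_smul' := fun c x => lie_smul c l x
      leibniz' := fun x y => by
        apply Subtype.ext
        change ⁅l, ⁅(x : L), (y : L)⁆⁆ = ⁅(x : L), ⁅l, (y : L)⁆⁆ - ⁅(y : L), ⁅l, (x : L)⁆⁆
        rw [leibniz_lie, ← lie_skew (y : L) ⁅l, (x : L)⁆]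
        abel }
  map_add' l l' := by ext n; exact congrArg Subtype.val (add_lie l l' n)
  map_smul' c l := by ext n; exact congrArg Subtype.val (smul_lie c l n)
  map_lie' {l l'} := by ext n; exact congrArg Subtype.val (lie_lie l l' n)

/-- The action of the ideal `N` on `L` by Lie multiplication, `ⁿl = [n, l]`. -/
def LieIdeal.actRight (N : LieIdeal F L) : N →ₗ⁅F⁆ LieDerivation F L L :=
  (LieDerivation.ad F L).comp N.incl

@[simp]
theorem LieIdeal.coe_actLeft (N : LieIdeal F L) (l : L) (n : N) :
    (N.actLeft l n : L) = ⁅l, (n : L)⁆ := rfl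

@[simp]
theorem LieIdeal.actRight_apply (N : LieIdeal F L) (l : L) (n : N) :
    N.actRight n l = ⁅(n : L), l⁆ := LieDerivation.ad_apply_apply F L n l

/-- The nonabelian tensor product `L ⊗ N` of a Lie algebra `L` and its ideal `N`. -/
abbrev LiePairTensor (N : LieIdeal F L) : Type (max u v) := LieTensor N.actLeft N.actRight

namespace LiePairTensor

/-- The commutator map `κ : L ⊗ N → L`, `l ⊗ n ↦ [l, n]`; its image is `[L, N]`. -/
def kappa (N : LieIdeal F L) : LiePairTensor N →ₗ⁅F⁆ L :=
  PresentedLie.lift (fun p => ⁅p.1, (p.2 : L)⁆) (by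
    rintro _ _ (_ | _ | _ | _ | ⟨l, l', n⟩ | ⟨l, n, n'⟩ | ⟨l, l', n, n'⟩)
    · simp
    · simp
    · simp
    · simp
    · simp only [FreeLieAlgebra.lift_of_apply, map_sub]
      exact lie_lie l l' (n : L)
    · simp only [FreeLieAlgebra.lift_of_apply, map_sub]
      rw [LieIdeal.actRight_apply, LieIdeal.actRight_apply]
      change ⁅l, ⁅(n : L), (n' : L)⁆⁆ = ⁅⁅(n' : L), l⁆, (n : L)⁆ - ⁅⁅(n : L), l⁆, (n' : L)⁆
      rw [leibniz_lie, ← lie_skew (n : L) ⁅l, (n' : L)⁆, ← lie_skew l (n : L),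
        ← lie_skew l (n' : L)]
      simp only [neg_lie, neg_neg]
      abel
    · simp only [FreeLieAlgebra.lift_of_apply, map_neg, LieHom.map_lie]
      rw [LieIdeal.actRight_apply, LieIdeal.coe_actLeft]
      change ⁅⁅l, (n : L)⁆, ⁅l', (n' : L)⁆⁆ = -⁅⁅(n : L), l⁆, ⁅l', (n' : L)⁆⁆
      rw [← lie_skew l (n : L), neg_lie])

@[simp]
theorem kappa_tmul (N : LieIdeal F L) (l : L) (n : N) :
    kappa N (LieTensor.tmul _ _ l n) = ⁅l, (n : L)⁆ :=
  PresentedLie.lift_of _ _ _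

/-- The homomorphism `L ⊗ N → L' ⊗ N'`, `l ⊗ n ↦ f l ⊗ f n`, induced by a homomorphism
`f : L → L'` with `f N ⊆ N'`. -/
def map {N : LieIdeal F L} {N' : LieIdeal F L'} (f : L →ₗ⁅F⁆ L') (h : ∀ x ∈ N, f x ∈ N') :
    LiePairTensor N →ₗ⁅F⁆ LiePairTensor N' :=
  PresentedLie.lift (fun p => LieTensor.tmul _ _ (f p.1) ⟨f p.2, h _ p.2.2⟩) (by
    have hl (l : L) (n : N) : (⟨f (N.actLeft l n), h _ (N.actLeft l n).2⟩ : N') =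
        N'.actLeft (f l) ⟨f n, h _ n.2⟩ := Subtype.ext (f.map_lie l (n : L))
    have hr (l : L) (n : N) : f (N.actRight n l) = N'.actRight ⟨f n, h _ n.2⟩ (f l) := by
      rw [LieIdeal.actRight_apply, LieIdeal.actRight_apply]
      exact f.map_lie (n : L) l
    rintro _ _ (⟨c, l, n⟩ | ⟨c, l, n⟩ | ⟨l, l', n⟩ | ⟨l, n, n'⟩ | ⟨l, l', n⟩ | ⟨l, n, n'⟩ |
      ⟨l, l', n, n'⟩)
    · simp only [FreeLieAlgebra.lift_of_apply, map_smul, LieTensor.smul_tmul]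
    · simp only [FreeLieAlgebra.lift_of_apply, map_smul]
      rw [← LieTensor.tmul_smul]
      exact congrArg (LieTensor.tmul _ _ (f l)) (Subtype.ext (map_smul f c (n : L)))
    · simp only [FreeLieAlgebra.lift_of_apply, map_add, LieTensor.add_tmul]
    · simp only [FreeLieAlgebra.lift_of_apply, map_add]
      rw [← LieTensor.tmul_add]
      exact congrArg (LieTensor.tmul _ _ (f l)) (Subtype.ext (map_add f (n : L) (n' : L)))
    · simp only [FreeLieAlgebra.lift_of_apply, map_sub, hl, LieHom.map_lie, LieTensor.lie_tmul]
    · simp only [FreeLieAlgebra.lift_of_apply, map_sub, hr]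
      rw [← LieTensor.tmul_lie]
      exact congrArg (LieTensor.tmul _ _ (f l)) (Subtype.ext (f.map_lie (n : L) (n' : L)))
    · simp only [FreeLieAlgebra.lift_of_apply, map_neg, LieHom.map_lie, hl, hr,
        LieTensor.lie_tmul_tmul])

@[simp]
theorem map_tmul {N : LieIdeal F L} {N' : LieIdeal F L'} (f : L →ₗ⁅F⁆ L')
    (h : ∀ x ∈ N, f x ∈ N') (l : L) (n : N) :
    map f h (LieTensor.tmul _ _ l n) = LieTensor.tmul _ _ (f l) ⟨f n, h _ n.2⟩ :=
  PresentedLie.lift_of _ _ _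

theorem kappa_map {N : LieIdeal F L} {N' : LieIdeal F L'} (f : L →ₗ⁅F⁆ L')
    (h : ∀ x ∈ N, f x ∈ N') (t : LiePairTensor N) : kappa N' (map f h t) = f (kappa N t) := by
  have : (kappa N').comp (map f h) = f.comp (kappa N) := by
    apply PresentedLie.hom_ext
    rintro ⟨l, n⟩
    change kappa N' (map f h (LieTensor.tmul _ _ l n)) = f (kappa N (LieTensor.tmul _ _ l n))
    simp
  exact LieHom.congr_fun this t

end LiePairTensor

/-- `J₂(L, N)`, the kernel of the commutator map `κ : L ⊗ N → [L, N]`. -/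
abbrev lieJ2 (N : LieIdeal F L) : LieIdeal F (LiePairTensor N) := (LiePairTensor.kappa N).ker

/-- The homomorphism `J₂(L, N) → J₂(L', N')` induced by `f : L → L'` with `f N ⊆ N'`. -/
def lieJ2Map {N : LieIdeal F L} {N' : LieIdeal F L'} (f : L →ₗ⁅F⁆ L') (h : ∀ x ∈ N, f x ∈ N') :
    lieJ2 N →ₗ⁅F⁆ lieJ2 N' where
  toFun t := ⟨LiePairTensor.map f h t, by
    rw [LieHom.mem_ker, LiePairTensor.kappa_map, LieHom.mem_ker.1 t.2, map_zero]⟩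
  map_add' _ _ := Subtype.ext (map_add _ _ _)
  map_smul' _ _ := Subtype.ext (map_smul _ _ _)
  map_lie' := Subtype.ext (LieHom.map_lie _ _ _)

/-- The canonical homomorphism `J₂(L₁ * L₂, N₁ * N₂) → J₂(L₁ ⊕ L₂, N₁ ⊕ N₂)`, induced by the
canonical epimorphism `L₁ * L₂ → L₁ ⊕ L₂`, where `N₁ * N₂` is an ideal `N` of `L₁ * L₂`. -/
def lieJ2ToProd {N₁ : LieIdeal F L} {N₂ : LieIdeal F L'} {N : LieIdeal F (LieFreeProduct F L L')}
    (hN : N.toLieSubalgebra = (LieFreeProduct.inclusion N₁ N₂).range) :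
    lieJ2 N →ₗ⁅F⁆ lieJ2 (lieIdealProd N₁ N₂) :=
  lieJ2Map (LieFreeProduct.toProd F L L') (LieFreeProduct.toProd_mem hN)

/-- The Lie algebra `N / [N, L]`. -/
abbrev LieIdeal.modLie (N : LieIdeal F L) : Type v :=
  N ⧸ LieIdeal.comap N.incl ⁅N, (⊤ : LieIdeal F L)⁆

end Pair

end

/-! Write `L = L₁ * L₂` and `P = L₁ ⊕ L₂`. In any `L ⊗ N` one has `[s, t] = κ s ⊗ κ t`
(`lie_eq_tmul`), so `J₂` is central: every bracket in the statement is zero, the image is an ideal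
for free, and only linear algebra is left.

The hypothesis that `N₁ * N₂` is an ideal is very restrictive. If `0 ≠ x ∈ N₁` and `y ∈ L₂`, then
`[y, x] ∈ N₁ * N₂`. For `y ∉ N₂`, faithful representations of `L₁` and `L₂ / N₂` yield an `L`-module
with a vector killed by `N₁` and `N₂` but not by `[y, x]`, a contradiction. Faithful representations
come from the Poincaré–Birkhoff–Witt action on standard monomials. Hence either both ideals are
everything, or both are zero, or one of `L₁`, `L₂` is zero; in the last two cases the map of `J₂` is
bijective and the tensor product on the right vanishes.

In the full case let `M = N₁ / [N₁, L₁] ⊗ N₂ / [N₂, L₂]`. The factors of `P` commute, so `P ⊗ P`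
splits as `(L₁ ⊗ L₁) ⊕ (L₂ ⊗ L₂) ⊕ M ⊕ M`, the copies of `M` coming from `x ⊗ y` and `y ⊗ x`. On the
side of `L`, the key is `apply_eq_zero_of_kappa`: a linear map `q` on `L ⊗ L` that kills the images
of `J₂(Lᵢ, Lᵢ)` and all `x ⊗ y + y ⊗ x` kills `J₂(L, L)`. Indeed `q (x ⊗ y)` is then an alternating
2-cocycle whose restrictions to the factors are coboundaries; on a free product it is itself a
coboundary (`exists_primitive`), so `q` factors through `κ`. Thus `J₂(L, L)` lies in the span of the
two squares and the symmetric elements. This span goes injectively into `P ⊗ P`, the symmetric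
elements onto the diagonal of `M ⊕ M`, and the difference of the two `M`-coordinates identifies the
cokernel on `J₂` with `M`. -/

noncomputable section

/-! ### A faithful representation of a Lie algebra with an ordered basis -/

section Faithful

variable {F : Type u} [CommRing F] {L : Type v} [LieRing L] [LieAlgebra F L]
variable {ι : Type w} (b : Module.Basis ι F L)

/-- The bilinear map `L × F[monomials] → F[monomials]` with prescribed values on basis vectors. -/
def monomialBilin (val : ι → Multiset ι → (Multiset ι →₀ F)) :
    L →ₗ[F] (Multiset ι →₀ F) →ₗ[F] (Multiset ι →₀ F) :=
  b.constr F fun i => Finsupp.linearCombination F (val i)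

@[simp]
theorem monomialBilin_apply (val : ι → Multiset ι → (Multiset ι →₀ F)) (i : ι) (m : Multiset ι) :
    monomialBilin b val (b i) (Finsupp.single m 1) = val i m := by
  simp [monomialBilin, Module.Basis.constr_basis]

@[elab_as_elim]
theorem basis_induction {p : L → Prop} (x : L) (zero : p 0)
    (add : ∀ x y, p x → p y → p (x + y)) (smul : ∀ (c : F) x, p x → p (c • x))
    (coe : ∀ i, p (b i)) : p x := by
  induction b.mem_span x using Submodule.span_induction with
  | mem x h => obtain ⟨i, rfl⟩ := h; exact coe i
  | zero => exact zero
  | add x y _ _ hx hy => exact add x y hx hy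
  | smul c x _ hx => exact smul c x hx

variable (F ι) in
/-- Combinations of monomials of degree at most `d`. -/
def monomialFiltration (d : ℕ) : Submodule F (Multiset ι →₀ F) :=
  Finsupp.supported F F {m | m.card ≤ d}

theorem single_mem_monomialFiltration {d : ℕ} {m : Multiset ι} (h : m.card ≤ d) :
    Finsupp.single m (1 : F) ∈ monomialFiltration F ι d :=
  Finsupp.single_mem_supported F 1 h

theorem monomialFiltration_mono {d e : ℕ} (h : d ≤ e) :
    monomialFiltration F ι d ≤ monomialFiltration F ι e :=
  Finsupp.supported_mono fun _ hm => le_trans hm h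

theorem monomialFiltration_induction {d : ℕ} {p : (Multiset ι →₀ F) → Prop}
    (single : ∀ m, Multiset.card m ≤ d → p (Finsupp.single m 1)) (zero : p 0)
    (add : ∀ s t, p s → p t → p (s + t)) (smul : ∀ (c : F) s, p s → p (c • s))
    {s : Multiset ι →₀ F} (hs : s ∈ monomialFiltration F ι d) : p s := by
  rw [monomialFiltration, Finsupp.supported_eq_span_single] at hs
  induction hs using Submodule.span_induction with
  | mem x h => obtain ⟨m, hm, rfl⟩ := h; exact single m hm
  | zero => exact zero
  | add x y _ _ hx hy => exact add x y hx hy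
  | smul c x _ hx => exact smul c x hx

variable [LinearOrder ι]

theorem Multiset.exists_min {m : Multiset ι} (h : m ≠ 0) : ∃ j ∈ m, ∀ k ∈ m, j ≤ k := by
  obtain ⟨j, hj, hmin⟩ := Finset.exists_min_image m.toFinset id
    (Multiset.toFinset_nonempty.2 h)
  exact ⟨j, by simpa using hj, fun k hk => hmin k (by simpa using hk)⟩

open Classical in
/-- Approximations to the left multiplication of `L` on standard monomials: `pbwApprox b d` is
correct on monomials of degree at most `d`. -/
def pbwApprox : ℕ → (L →ₗ[F] (Multiset ι →₀ F) →ₗ[F] (Multiset ι →₀ F))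
  | 0 => monomialBilin b fun i m => Finsupp.single (i ::ₘ m) 1
  | d + 1 => monomialBilin b fun i m =>
      if m.card ≤ d then pbwApprox d (b i) (Finsupp.single m 1)
      -- For `m = j :: n` with `j` least, this encodes `x_i x_j n = x_j x_i n + [x_i, x_j] n`. The
      -- leading part `i :: n` of `x_i n` is split off, as `x_j` must send it to `i :: m`; the
      -- recursion then only meets degree at most `d`.
      else if h : ∃ j ∈ m, (∀ k ∈ m, j ≤ k) ∧ j < i then
        Finsupp.single (i ::ₘ m) 1 +
          pbwApprox d (b h.choose) (pbwApprox d (b i) (Finsupp.single (m.erase h.choose) 1) -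
            Finsupp.single (i ::ₘ m.erase h.choose) 1) +
          pbwApprox d ⁅b i, b h.choose⁆ (Finsupp.single (m.erase h.choose) 1)
      else Finsupp.single (i ::ₘ m) 1

/-- The action of `L` on standard monomials by left multiplication. -/
def pbwAct : L →ₗ[F] (Multiset ι →₀ F) →ₗ[F] (Multiset ι →₀ F) :=
  monomialBilin b fun i m => pbwApprox b m.card (b i) (Finsupp.single m 1)

theorem pbwApprox_single {d : ℕ} {m : Multiset ι} (h : m.card ≤ d) (i : ι) :
    pbwApprox b d (b i) (Finsupp.single m 1) = pbwAct b (b i) (Finsupp.single m 1) := by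
  induction d with
  | zero => simp [pbwAct, Nat.le_zero.1 h]
  | succ d ih =>
    rcases Nat.lt_or_ge d m.card with h' | h'
    · simp [pbwAct, le_antisymm h h']
    · rw [← ih h', pbwApprox, monomialBilin_apply, if_pos h']

theorem pbwApprox_eq {d : ℕ} {s : Multiset ι →₀ F} (hs : s ∈ monomialFiltration F ι d) (x : L) :
    pbwApprox b d x s = pbwAct b x s := by
  refine monomialFiltration_induction (p := fun s => pbwApprox b d x s = pbwAct b x s)
    (fun m hm => ?_) (by simp) (fun s t hs ht => by simp [hs, ht])
    (fun c s hs => by simp [hs]) hs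
  have : (pbwApprox b d).flip (Finsupp.single m 1) = (pbwAct b).flip (Finsupp.single m 1) :=
    b.ext fun i => pbwApprox_single b hm i
  exact LinearMap.congr_fun this x

theorem pbwAct_single_of_le {i : ι} {m : Multiset ι} (h : ∀ j ∈ m, i ≤ j) :
    pbwAct b (b i) (Finsupp.single m 1) = Finsupp.single (i ::ₘ m) 1 := by
  rw [← pbwApprox_single b le_rfl]
  cases hd : m.card with
  | zero => simp [pbwApprox]
  | succ d =>
    rw [pbwApprox, monomialBilin_apply, if_neg (by omega), dif_neg]
    rintro ⟨j, hj, -, hji⟩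
    exact (h j hj).not_gt hji

/-- One `pbwApprox` stays in the formula: replacing it by `pbwAct` needs the degree bound of
`pbwAct_sub_single_mem`, whose proof uses this formula. -/
theorem pbwAct_single_cons {i j : ι} {m : Multiset ι} (hji : j < i) (h : ∀ k ∈ m, j ≤ k) :
    pbwAct b (b i) (Finsupp.single (j ::ₘ m) 1) = Finsupp.single (i ::ₘ j ::ₘ m) 1 +
      pbwApprox b m.card (b j) (pbwAct b (b i) (Finsupp.single m 1) -
        Finsupp.single (i ::ₘ m) 1) + pbwAct b ⁅b i, b j⁆ (Finsupp.single m 1) := by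
  rw [← pbwApprox_single b (d := m.card + 1) (by simp), pbwApprox, monomialBilin_apply,
    if_neg (by simp)]
  have hex : ∃ j' ∈ j ::ₘ m, (∀ k ∈ j ::ₘ m, j' ≤ k) ∧ j' < i :=
    ⟨j, by simp, by simpa using h, hji⟩
  have hj : hex.choose = j := by
    obtain ⟨h₁, h₂, -⟩ := hex.choose_spec
    refine le_antisymm (h₂ j (by simp)) ?_
    rcases Multiset.mem_cons.1 h₁ with h₁ | h₁
    · exact h₁.ge
    · exact h _ h₁
  rw [dif_pos hex, hj, Multiset.erase_cons_head,
    pbwApprox_eq b (single_mem_monomialFiltration le_rfl),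
    pbwApprox_eq b (single_mem_monomialFiltration le_rfl)]

/-- Modulo lower degree, `b i` acts as multiplication by a variable. By induction on the degree,
since the correction terms of the recursion apply at most two operators to a shorter monomial, and
`key` bounds what each operator does below degree `m.card`. -/
theorem pbwAct_sub_single_mem (i : ι) (m : Multiset ι) :
    pbwAct b (b i) (Finsupp.single m 1) - Finsupp.single (i ::ₘ m) 1 ∈
      monomialFiltration F ι m.card := by
  induction hd : m.card using Nat.strong_induction_on generalizing i m with
  | _ d ih =>
  subst hd
  have key : ∀ e < m.card, ∀ x, ∀ s ∈ monomialFiltration F ι e,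
      pbwAct b x s ∈ monomialFiltration F ι (e + 1) := by
    intro e he x s hs
    refine monomialFiltration_induction
      (p := fun s => pbwAct b x s ∈ monomialFiltration F ι (e + 1))
      (fun n hn => ?_) (by simp) (fun s t hs ht => by simpa using add_mem hs ht)
      (fun c s hs => by simpa using Submodule.smul_mem _ c hs) hs
    induction x using basis_induction b with
    | zero => simp
    | add x y hx hy => simpa using add_mem hx hy
    | smul c x hx => simpa using Submodule.smul_mem _ c hx
    | coe j =>
      rw [← sub_add_cancel (pbwAct b (b j) (Finsupp.single n 1)) (Finsupp.single (j ::ₘ n) 1)]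
      exact add_mem (monomialFiltration_mono (by omega) (ih _ (by omega) j n rfl))
        (single_mem_monomialFiltration (by simp; omega))
  by_cases hi : ∀ j ∈ m, i ≤ j
  · simp [pbwAct_single_of_le b hi]
  · have hm : m ≠ 0 := by rintro rfl; simp at hi
    obtain ⟨j, hj, hmin⟩ := Multiset.exists_min hm
    obtain ⟨n, rfl⟩ := Multiset.exists_cons_of_mem hj
    have hji : j < i := by
      by_contra hc
      exact hi fun k hk => (not_lt.1 hc).trans (hmin k hk)
    rw [pbwAct_single_cons b hji fun k hk => hmin k (by simp [hk]), add_assoc,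
      add_sub_cancel_left, Multiset.card_cons]
    have hn := ih n.card (by simp) i n rfl
    rw [pbwApprox_eq b hn]
    exact add_mem (key _ (by simp) _ _ hn)
      (key _ (by simp) _ _ (single_mem_monomialFiltration le_rfl))

/-- The case which the recursion imposes: the leading term and the correction recombine to `b j`
applied to `b i` on `m`. -/
theorem pbwAct_comm_of_le {i j : ι} {m : Multiset ι} (hji : j < i) (h : ∀ k ∈ m, j ≤ k) :
    pbwAct b (b i) (pbwAct b (b j) (Finsupp.single m 1)) =
      pbwAct b (b j) (pbwAct b (b i) (Finsupp.single m 1)) +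
        pbwAct b ⁅b i, b j⁆ (Finsupp.single m 1) := by
  rw [pbwAct_single_of_le b h, pbwAct_single_cons b hji h,
    pbwApprox_eq b (pbwAct_sub_single_mem b i m), map_sub,
    pbwAct_single_of_le b (i := j) (m := i ::ₘ m) (by simpa using ⟨hji.le, h⟩),
    Multiset.cons_swap]
  abel

theorem pbwAct_comm_of_basis {m : Multiset ι}
    (h : ∀ i j, j < i → pbwAct b (b i) (pbwAct b (b j) (Finsupp.single m 1)) =
      pbwAct b (b j) (pbwAct b (b i) (Finsupp.single m 1)) +
        pbwAct b ⁅b i, b j⁆ (Finsupp.single m 1)) (x y : L) :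
    pbwAct b x (pbwAct b y (Finsupp.single m 1)) =
      pbwAct b y (pbwAct b x (Finsupp.single m 1)) + pbwAct b ⁅x, y⁆ (Finsupp.single m 1) := by
  induction x using basis_induction b with
  | zero => simp
  | add x x' hx hx' => simp only [map_add, LinearMap.add_apply, add_lie, hx, hx']; abel
  | smul c x hx => simp only [map_smul, LinearMap.smul_apply, smul_lie, hx, smul_add]
  | coe i =>
    induction y using basis_induction b with
    | zero => simp
    | add y y' hy hy' => simp only [map_add, LinearMap.add_apply, lie_add, hy, hy']; abel
    | smul c y hy => simp only [map_smul, LinearMap.smul_apply, lie_smul, hy, smul_add]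
    | coe j =>
      rcases lt_trichotomy i j with hij | rfl | hij
      · rw [h j i hij, ← lie_skew (b j) (b i), map_neg, LinearMap.neg_apply]
        abel
      · simp
      · exact h i j hij

/-- The heart of the construction, by induction on the degree. If `j < i` and `j` is not least,
write `m = k :: n` with `k` least and move `b k` to the left in all terms; the remaining discrepancy
is the Jacobi identity. -/
theorem pbwAct_comm_single (m : Multiset ι) (x y : L) :
    pbwAct b x (pbwAct b y (Finsupp.single m 1)) =
      pbwAct b y (pbwAct b x (Finsupp.single m 1)) + pbwAct b ⁅x, y⁆ (Finsupp.single m 1) := by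
  induction hd : m.card using Nat.strong_induction_on generalizing m x y with
  | _ d ih =>
  subst hd
  refine pbwAct_comm_of_basis b (fun i j hji => ?_) x y
  by_cases hj : ∀ k ∈ m, j ≤ k
  · exact pbwAct_comm_of_le b hji hj
  have hm : m ≠ 0 := by rintro rfl; simp at hj
  obtain ⟨k, hk, hmin⟩ := Multiset.exists_min hm
  obtain ⟨n, rfl⟩ := Multiset.exists_cons_of_mem hk
  have hkj : k < j := by
    by_contra hc
    exact hj fun l hl => (not_lt.1 hc).trans (hmin l hl)
  have hkn : ∀ l ∈ n, k ≤ l := fun l hl => hmin l (by simp [hl])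
  have ihn := fun x y => ih n.card (by simp) n x y rfl
  have ihs : ∀ x y, ∀ s ∈ monomialFiltration F ι n.card,
      pbwAct b x (pbwAct b y s) = pbwAct b y (pbwAct b x s) + pbwAct b ⁅x, y⁆ s := by
    intro x y s hs
    refine monomialFiltration_induction
      (p := fun s => pbwAct b x (pbwAct b y s) = pbwAct b y (pbwAct b x s) + pbwAct b ⁅x, y⁆ s)
      (fun m hm => ih _ (by simp; omega) m x y rfl) (by simp)
      (fun s t hs ht => by simp only [map_add, hs, ht]; abel)
      (fun c s hs => by simp only [map_smul, hs, smul_add]) hs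
  -- `b q` applied to `n` may have the degree of `m`, out of reach of the induction. On its leading
  -- monomial `q :: n` the index `k` is least and `pbwAct_comm_of_le` applies; the rest has degree
  -- at most `n.card`.
  have swap : ∀ p q, k < p → k < q →
      pbwAct b (b p) (pbwAct b (b k) (pbwAct b (b q) (Finsupp.single n 1))) =
        pbwAct b (b k) (pbwAct b (b p) (pbwAct b (b q) (Finsupp.single n 1))) +
          pbwAct b ⁅b p, b k⁆ (pbwAct b (b q) (Finsupp.single n 1)) := by
    intro p q hp hq
    have h₁ := ihs (b p) (b k) _ (pbwAct_sub_single_mem b q n)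
    have h₂ := pbwAct_comm_of_le b (m := q ::ₘ n) hp (by simpa using ⟨hq.le, hkn⟩)
    simp only [map_sub] at h₁
    rw [h₂] at h₁
    rw [sub_eq_iff_eq_add.1 h₁]
    abel
  have expand : ∀ p q, k < p → k < q →
      pbwAct b (b p) (pbwAct b (b q) (pbwAct b (b k) (Finsupp.single n 1))) =
        pbwAct b (b k) (pbwAct b (b p) (pbwAct b (b q) (Finsupp.single n 1))) +
        pbwAct b ⁅b p, b k⁆ (pbwAct b (b q) (Finsupp.single n 1)) +
        pbwAct b ⁅b q, b k⁆ (pbwAct b (b p) (Finsupp.single n 1)) +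
        pbwAct b ⁅b p, ⁅b q, b k⁆⁆ (Finsupp.single n 1) := by
    intro p q hp hq
    rw [ihn (b q) (b k), map_add, swap p q hp hq, ihn (b p) ⁅b q, b k⁆]
    abel
  rw [← pbwAct_single_of_le b hkn, expand i j (hkj.trans hji) hkj,
    expand j i hkj (hkj.trans hji), ihn ⁅b i, b j⁆ (b k), ihn (b i) (b j), lie_lie, map_add,
    map_sub, LinearMap.sub_apply]
  abel

end Faithful

section FaithfulEnd

attribute [local instance] LieRing.ofAssociativeRing

/-- The representation of `L` on standard monomials. -/
def pbwHom {F : Type u} [CommRing F] {L : Type v} [LieRing L] [LieAlgebra F L] {ι : Type w}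
    [LinearOrder ι] (b : Module.Basis ι F L) : L →ₗ⁅F⁆ Module.End F (Multiset ι →₀ F) :=
  { pbwAct b with
    map_lie' := by
      intro x y
      refine Finsupp.lhom_ext' fun m => LinearMap.ext_ring ?_
      exact (sub_eq_of_eq_add' (pbwAct_comm_single b m x y)).symm }

/-- A finite-dimensional Lie algebra has a faithful representation. -/
theorem exists_injective_lieHom_end (F : Type u) [Field F] (L : Type v) [LieRing L]
    [LieAlgebra F L] [FiniteDimensional F L] :
    ∃ (V : Type u) (_ : AddCommGroup V) (_ : Module F V) (ρ : L →ₗ⁅F⁆ Module.End F V),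
      Function.Injective ρ := by
  let b := Module.finBasis F L
  refine ⟨_, inferInstance, inferInstance, pbwHom b, fun x y hxy => ?_⟩
  -- A left inverse of `x ↦ x · 1`; only its values on monomials of degree one matter.
  let proj : (Multiset (Fin (Module.finrank F L)) →₀ F) →ₗ[F] L :=
    Finsupp.linearCombination F fun m => (m.map b).sum
  have h : ∀ x, proj (pbwHom b x (Finsupp.single 0 1)) = x := by
    intro x
    induction x using basis_induction b with
    | zero => simp
    | add x y hx hy => simp only [map_add, LinearMap.add_apply, hx, hy]
    | smul c x hx => simp only [map_smul, LinearMap.smul_apply, hx]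
    | coe i =>
      have : pbwHom b (b i) (Finsupp.single 0 1) = Finsupp.single (i ::ₘ 0) 1 :=
        pbwAct_single_of_le b (by simp)
      simp [this, proj]
  rw [← h x, hxy, h]

end FaithfulEnd

/-! ### When the subalgebra generated by two ideals is an ideal of the free product -/

section SubalgebraIdeal

attribute [local instance] LieRing.ofAssociativeRing

variable {F : Type u} [Field F]

/-- Given `x ≠ 0` in `A` and `y ∉ I` in `B`, there are representations of `A` and `B` on one space
and a vector killed by `A` and `I` whose image under `y` is not killed by `x`. -/
theorem exists_pair_end {A : Type v} [LieRing A] [LieAlgebra F A] [FiniteDimensional F A]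
    {B : Type w} [LieRing B] [LieAlgebra F B] [FiniteDimensional F B] (I : LieIdeal F B)
    {x : A} (hx : x ≠ 0) {y : B} (hy : y ∉ I) :
    ∃ (W : Type u) (_ : AddCommGroup W) (_ : Module F W) (f : A →ₗ⁅F⁆ Module.End F W)
      (g : B →ₗ⁅F⁆ Module.End F W) (v : W), (∀ a, f a v = 0) ∧ (∀ z ∈ I, g z v = 0) ∧
        f x (g y v) ≠ 0 := by
  obtain ⟨V₁, _, _, ρ₁, h₁⟩ := exists_injective_lieHom_end F A
  obtain ⟨V₂, _, _, ρ₂, h₂⟩ := exists_injective_lieHom_end F (B ⧸ I)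
  let π : B →ₗ⁅F⁆ B ⧸ I := { (LieSubmodule.Quotient.mk' I : B →ₗ[F] B ⧸ I) with map_lie' := fun {_ _} => rfl }
  have hπ : ∀ z, π z = 0 ↔ z ∈ I := fun z => LieSubmodule.Quotient.mk_eq_zero I
  have hρ₁ : ρ₁ x ≠ 0 := fun h => hx (h₁ (h.trans (map_zero ρ₁).symm))
  have hρ₂ : ρ₂ (π y) ≠ 0 := fun h => hy ((hπ y).1 (h₂ (h.trans (map_zero ρ₂).symm)))
  obtain ⟨v₁, hv₁⟩ : ∃ v, ρ₁ x v ≠ 0 := by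
    by_contra! h
    exact hρ₁ (LinearMap.ext h)
  obtain ⟨v₂, hv₂⟩ : ∃ v, ρ₂ (π y) v ≠ 0 := by
    by_contra! h
    exact hρ₂ (LinearMap.ext h)
  -- The functionals serve to show that the pure tensor `ρ₁ x v₁ ⊗ ρ₂ (π y) v₂` is nonzero.
  obtain ⟨φ₁, hφ₁⟩ : ∃ φ : Module.Dual F V₁, φ (ρ₁ x v₁) ≠ 0 := by
    by_contra! h
    exact hv₁ ((Module.forall_dual_apply_eq_zero_iff F _).1 h)
  obtain ⟨φ₂, hφ₂⟩ : ∃ φ : Module.Dual F V₂, φ (ρ₂ (π y) v₂) ≠ 0 := by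
    by_contra! h
    exact hv₂ ((Module.forall_dual_apply_eq_zero_iff F _).1 h)
  let f : A →ₗ⁅F⁆ Module.End F ((V₁ ⊗[F] V₂) × F) :=
    { toFun := fun a => LinearMap.inl F _ F ∘ₗ (ρ₁ a).rTensor V₂ ∘ₗ LinearMap.fst F _ F
      map_add' := fun a b => by
        ext <;> simp
      map_smul' := fun c a => by
        ext <;> simp [TensorProduct.smul_tmul']
      map_lie' := fun {a b} => by
        ext <;> simp [LieRing.of_associative_ring_bracket] }
  -- The second summand `F` is spanned by the vector sought. The last map sends it to `v₁ ⊗ v₂` and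
  -- is a left inverse of `inl`, so composites telescope and `g` preserves brackets. Thus `B` moves
  -- the vector as it moves `v₁ ⊗ v₂`, while `A` kills it.
  let g : B →ₗ⁅F⁆ Module.End F ((V₁ ⊗[F] V₂) × F) :=
    { toFun := fun a => LinearMap.inl F _ F ∘ₗ (ρ₂ (π a)).lTensor V₁ ∘ₗ
        (LinearMap.id.coprod (LinearMap.toSpanSingleton F _ (v₁ ⊗ₜ v₂)))
      map_add' := fun a b => by
        ext <;> simp
      map_smul' := fun c a => by
        ext <;> simp
      map_lie' := fun {a b} => by
        ext <;> simp [LieRing.of_associative_ring_bracket] }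
  refine ⟨_, inferInstance, inferInstance, f, g, (0, 1), fun a => ?_, fun z hz => ?_, ?_⟩
  · simp [f]
  · simp [g, (hπ z).2 hz]
  · have : f x (g y (0, 1)) = (ρ₁ x v₁ ⊗ₜ ρ₂ (π y) v₂, 0) := by simp [f, g]
    rw [this]
    intro h
    have h0 := congrArg Prod.fst h
    have h0' := congrArg (LinearMap.mul' F F ∘ₗ TensorProduct.map φ₁ φ₂) h0
    simp [hφ₁, hφ₂] at h0'

variable {L₁ : Type v} [LieRing L₁] [LieAlgebra F L₁]
variable {L₂ : Type w} [LieRing L₂] [LieAlgebra F L₂]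

/-- A vector killed by `N₁` and `N₂` is killed by the subalgebra which they generate. -/
theorem LieFreeProduct.lift_inclusion_apply_eq_zero {W : Type*} [AddCommGroup W] [Module F W]
    (N₁ : LieIdeal F L₁) (N₂ : LieIdeal F L₂) (f : L₁ →ₗ⁅F⁆ Module.End F W)
    (g : L₂ →ₗ⁅F⁆ Module.End F W) {v : W} (hf : ∀ x ∈ N₁, f x v = 0) (hg : ∀ x ∈ N₂, g x v = 0)
    (z : LieFreeProduct F N₁ N₂) : lift f g (inclusion N₁ N₂ z) v = 0 := by
  let S : LieSubalgebra F (Module.End F W) :=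
    { LinearMap.ker (LinearMap.applyₗ (R := F) v) with
      lie_mem' := fun {a b} ha hb => by
        have ha' : a v = 0 := ha
        have hb' : b v = 0 := hb
        change ⁅a, b⁆ v = 0
        simp [LieRing.of_associative_ring_bracket, ha', hb'] }
  let f' : N₁ →ₗ⁅F⁆ S :=
    { ((f : L₁ →ₗ[F] Module.End F W) ∘ₗ N₁.toSubmodule.subtype).codRestrict S.toSubmodule
        (fun x => hf x x.2) with
      map_lie' := fun {x y} => Subtype.ext (f.map_lie x y) }
  let g' : N₂ →ₗ⁅F⁆ S :=
    { ((g : L₂ →ₗ[F] Module.End F W) ∘ₗ N₂.toSubmodule.subtype).codRestrict S.toSubmodule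
        (fun x => hg x x.2) with
      map_lie' := fun {x y} => Subtype.ext (g.map_lie x y) }
  have : (lift f g).comp (inclusion N₁ N₂) = S.incl.comp (lift f' g') := by
    apply hom_ext
    · intro x
      simp [inclusion]
      rfl
    · intro x
      simp [inclusion]
      rfl
  have h := LieHom.congr_fun this z
  change lift f g (inclusion N₁ N₂ z) = _ at h
  rw [h]
  exact (lift f' g' z).2

variable {N₁ : LieIdeal F L₁}
  {N₂ : LieIdeal F L₂} {N : LieIdeal F (LieFreeProduct F L₁ L₂)}

open LieFreeProduct

theorem LieFreeProduct.inl_mem (hN : N.toLieSubalgebra = (inclusion N₁ N₂).range) {x : L₁}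
    (hx : x ∈ N₁) : inl F L₁ L₂ x ∈ N := by
  change _ ∈ N.toLieSubalgebra
  rw [hN]
  exact ⟨inl F N₁ N₂ ⟨x, hx⟩, lift_inl _ _ _⟩

theorem LieFreeProduct.inr_mem (hN : N.toLieSubalgebra = (inclusion N₁ N₂).range) {x : L₂}
    (hx : x ∈ N₂) : inr F L₁ L₂ x ∈ N := by
  change _ ∈ N.toLieSubalgebra
  rw [hN]
  exact ⟨inr F N₁ N₂ ⟨x, hx⟩, lift_inr _ _ _⟩

theorem LieFreeProduct.lift_apply_eq_zero {W : Type*} [AddCommGroup W] [Module F W]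
    (hN : N.toLieSubalgebra = (inclusion N₁ N₂).range) (f : L₁ →ₗ⁅F⁆ Module.End F W)
    (g : L₂ →ₗ⁅F⁆ Module.End F W) {v : W} (hf : ∀ x ∈ N₁, f x v = 0) (hg : ∀ x ∈ N₂, g x v = 0)
    {z : LieFreeProduct F L₁ L₂} (hz : z ∈ N) : lift f g z v = 0 := by
  change z ∈ N.toLieSubalgebra at hz
  rw [hN] at hz
  obtain ⟨z, rfl⟩ := hz
  exact lift_inclusion_apply_eq_zero N₁ N₂ f g hf hg z

variable [FiniteDimensional F L₁] [FiniteDimensional F L₂]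

/-- Otherwise `[y, x] ∈ N` kills the vector `v` of `exists_pair_end`; as `x v = 0`, this says `x (y
v) = 0`, contrary to the choice of `v`. -/
theorem LieFreeProduct.mem_right_of_ne_zero (hN : N.toLieSubalgebra = (inclusion N₁ N₂).range)
    {x : L₁} (hx : x ∈ N₁) (h0 : x ≠ 0) (y : L₂) : y ∈ N₂ := by
  by_contra hy
  obtain ⟨W, _, _, f, g, v, hf, hg, hne⟩ := exists_pair_end N₂ h0 hy
  have h := lift_apply_eq_zero hN f g (fun x _ => hf x) hg
    (N.lie_mem (x := inr F L₁ L₂ y) (inl_mem hN hx))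
  rw [LieHom.map_lie, lift_inl, lift_inr, LieRing.of_associative_ring_bracket] at h
  apply hne
  simpa [hf] using h

theorem LieFreeProduct.mem_left_of_ne_zero (hN : N.toLieSubalgebra = (inclusion N₁ N₂).range)
    {x : L₂} (hx : x ∈ N₂) (h0 : x ≠ 0) (y : L₁) : y ∈ N₁ := by
  by_contra hy
  obtain ⟨W, _, _, f, g, v, hf, hg, hne⟩ := exists_pair_end N₁ h0 hy
  have h := lift_apply_eq_zero hN g f hg (fun x _ => hf x)
    (N.lie_mem (x := inl F L₁ L₂ y) (inr_mem hN hx))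
  rw [LieHom.map_lie, lift_inl, lift_inr, LieRing.of_associative_ring_bracket] at h
  apply hne
  simpa [hf] using h

end SubalgebraIdeal

/-! ### Linear structure of nonabelian tensor products -/

section TensorLinear

variable {F : Type u} [CommRing F]

/-- A vector space as a Lie algebra with zero bracket. -/
abbrev zeroLieRing (V : Type*) [AddCommGroup V] : LieRing V where
  bracket _ _ := 0
  add_lie _ _ _ := (add_zero 0).symm
  lie_add _ _ _ := (add_zero 0).symm
  lie_self _ := rfl
  leibniz_lie _ _ _ := (add_zero 0).symm

namespace LieTensor

variable {L : Type v} [LieRing L] [LieAlgebra F L] {N : Type w} [LieRing N] [LieAlgebra F N]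
variable (a : L →ₗ⁅F⁆ LieDerivation F N N) (b : N →ₗ⁅F⁆ LieDerivation F L L)

/-- The bilinear map `(l, n) ↦ l ⊗ n`. -/
def tmulₗ : L →ₗ[F] N →ₗ[F] LieTensor a b :=
  LinearMap.mk₂ F (tmul a b) (add_tmul a b) (smul_tmul a b) (tmul_add a b) fun c l n =>
    tmul_smul a b c l n

@[simp]
theorem tmulₗ_apply (l : L) (n : N) : tmulₗ a b l n = tmul a b l n := rfl

theorem zero_tmul (n : N) : tmul a b 0 n = 0 := LinearMap.map_zero₂ (tmulₗ a b) n

theorem tmul_zero (l : L) : tmul a b l 0 = 0 := map_zero (tmulₗ a b l)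

/-- The elements `l ⊗ n` span the tensor product as a module. -/
theorem mem_span_tmul (t : LieTensor a b) :
    t ∈ Submodule.span F (Set.range fun p : L × N => tmul a b p.1 p.2) := by
  -- The bracket of two generators is minus a generator, so the span is a subalgebra and the
  -- quotient map from the free Lie algebra factors through it.
  let S : LieSubalgebra F (LieTensor a b) :=
    { Submodule.span F (Set.range fun p : L × N => tmul a b p.1 p.2) with
      lie_mem' := by
        intro x y hx hy
        change x ∈ Submodule.span F _ at hx
        change y ∈ Submodule.span F _ at hy
        change ⁅x, y⁆ ∈ Submodule.span F _
        induction hx using Submodule.span_induction with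
        | zero => simp
        | add x x' _ _ hx hx' => rw [add_lie]; exact add_mem hx hx'
        | smul c x _ hx => rw [smul_lie]; exact Submodule.smul_mem _ c hx
        | mem x hx =>
          obtain ⟨p, rfl⟩ := hx
          induction hy using Submodule.span_induction with
          | zero => simp
          | add y y' _ _ hy hy' => rw [lie_add]; exact add_mem hy hy'
          | smul c y _ hy => rw [lie_smul]; exact Submodule.smul_mem _ c hy
          | mem y hy =>
            obtain ⟨p', rfl⟩ := hy
            simp only [lie_tmul_tmul]
            exact neg_mem (Submodule.subset_span ⟨(_, _), rfl⟩) }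
  let f : FreeLieAlgebra F (L × N) →ₗ⁅F⁆ S :=
    FreeLieAlgebra.lift F fun p => ⟨tmul a b p.1 p.2, Submodule.subset_span ⟨p, rfl⟩⟩
  have hf : S.incl.comp f = PresentedLie.mk _ := by
    apply FreeLieAlgebra.hom_ext
    intro p
    change ((f (FreeLieAlgebra.of F p) : S) : LieTensor a b) = _
    simp only [f, FreeLieAlgebra.lift_of_apply]
    rfl
  obtain ⟨z, rfl⟩ := PresentedLie.mk_surjective t
  rw [← hf]
  exact (f z).2

variable {a b}

@[elab_as_elim]
theorem induction_on {p : LieTensor a b → Prop} (t : LieTensor a b)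
    (tmul : ∀ l n, p (tmul a b l n)) (add : ∀ s t, p s → p t → p (s + t)) : p t := by
  -- Proving `p` for all multiples makes a separate scalar case superfluous: scalars are absorbed in
  -- the left factor.
  have h : ∀ c : F, p (c • t) := by
    induction mem_span_tmul a b t using Submodule.span_induction with
    | mem t h => obtain ⟨q, rfl⟩ := h; exact fun c => smul_tmul a b c q.1 q.2 ▸ tmul _ _
    | zero => exact fun c => by rw [smul_zero, ← zero_tmul a b 0]; exact tmul _ _
    | add s t _ _ hs ht => exact fun c => by rw [smul_add]; exact add _ _ (hs c) (ht c)
    | smul d t _ ht => exact fun c => by rw [smul_smul]; exact ht _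
  simpa using h 1

theorem linearMap_ext {V : Type*} [AddCommGroup V] [Module F V] {f g : LieTensor a b →ₗ[F] V}
    (h : ∀ l n, f (tmul a b l n) = g (tmul a b l n)) : f = g := by
  ext t
  induction t using induction_on with
  | tmul l n => exact h l n
  | add s t hs ht => rw [map_add, map_add, hs, ht]

/-- The linear map on a nonabelian tensor product given by a bilinear map which respects the
relations, for the zero bracket on the target. -/
def liftLinear {V : Type*} [AddCommGroup V] [Module F V] (β : L →ₗ[F] N →ₗ[F] V)
    (h₁ : ∀ l l' n, β ⁅l, l'⁆ n = β l (a l' n) - β l' (a l n))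
    (h₂ : ∀ l n n', β l ⁅n, n'⁆ = β (b n' l) n - β (b n l) n')
    (h₃ : ∀ l l' n n', β (b n l) (a l' n') = 0) : LieTensor a b →ₗ[F] V :=
  letI : LieRing V := zeroLieRing V
  letI : LieAlgebra F V := { ‹Module F V› with lie_smul := fun _ _ _ => (smul_zero _).symm }
  (PresentedLie.lift (r := LieTensorRel a b) (M := V) (fun p => β p.1 p.2) (by
    rintro _ _ (⟨c, l, n⟩ | ⟨c, l, n⟩ | ⟨l, l', n⟩ | ⟨l, n, n'⟩ | ⟨l, l', n⟩ | ⟨l, n, n'⟩ |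
      ⟨l, l', n, n'⟩)
    · simp
    · simp
    · simp
    · simp
    · simp [h₁]
    · simp [h₂]
    · simp only [LieHom.map_lie, FreeLieAlgebra.lift_of_apply, map_neg, h₃, neg_zero]
      rfl) : LieTensor a b →ₗ[F] V)

@[simp]
theorem liftLinear_tmul {V : Type*} [AddCommGroup V] [Module F V] (β : L →ₗ[F] N →ₗ[F] V)
    (h₁ : ∀ l l' n, β ⁅l, l'⁆ n = β l (a l' n) - β l' (a l n))
    (h₂ : ∀ l n n', β l ⁅n, n'⁆ = β (b n' l) n - β (b n l) n')
    (h₃ : ∀ l l' n n', β (b n l) (a l' n') = 0) (l : L) (n : N) :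
    liftLinear β h₁ h₂ h₃ (tmul a b l n) = β l n :=
  letI : LieRing V := zeroLieRing V
  letI : LieAlgebra F V := { ‹Module F V› with lie_smul := fun _ _ _ => (smul_zero _).symm }
  PresentedLie.lift_of (M := V) _ _ _

/-- The bracket of a nonabelian tensor product with trivial actions is zero. -/
theorem lie_eq_zero_of_trivial (s t : LieTensor (0 : L →ₗ⁅F⁆ LieDerivation F N N)
    (0 : N →ₗ⁅F⁆ LieDerivation F L L)) : ⁅s, t⁆ = 0 := by
  induction s using induction_on with
  | add s s' hs hs' => rw [add_lie, hs, hs', add_zero]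
  | tmul l n =>
    induction t using induction_on with
    | add t t' ht ht' => rw [lie_add, ht, ht', add_zero]
    | tmul l' n' =>
      rw [lie_tmul_tmul]
      change -tmul _ _ _ (0 : N) = 0
      rw [tmul_zero, neg_zero]

/-- The nonabelian tensor product of abelian Lie algebras with trivial actions is the usual tensor
product. -/
def equivTensorProduct (hL : ∀ x y : L, ⁅x, y⁆ = 0) (hN : ∀ x y : N, ⁅x, y⁆ = 0) :
    LieTensor (0 : L →ₗ⁅F⁆ LieDerivation F N N) (0 : N →ₗ⁅F⁆ LieDerivation F L L) ≃ₗ[F]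
      L ⊗[F] N :=
  LinearEquiv.ofLinearMap
    (liftLinear (TensorProduct.mk F L N)
      (fun l l' n => by
        change _ = TensorProduct.mk F L N l (0 : N) - TensorProduct.mk F L N l' (0 : N)
        simp [hL])
      (fun l n n' => by
        change _ = TensorProduct.mk F L N (0 : L) n - TensorProduct.mk F L N (0 : L) n'
        simp [hN])
      (fun l l' n n' => by
        change TensorProduct.mk F L N (0 : L) (0 : N) = 0
        simp))
    (TensorProduct.lift (tmulₗ _ _))
    (TensorProduct.ext' fun x y => by simp)
    (linearMap_ext fun l n => by simp)

end LieTensor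

namespace LiePairTensor

open LieTensor

variable {L : Type v} [LieRing L] [LieAlgebra F L] {N : LieIdeal F L}

theorem kappa_mem (t : LiePairTensor N) : kappa N t ∈ N := by
  induction t using LieTensor.induction_on with
  | tmul l n => rw [kappa_tmul]; exact N.lie_mem n.2
  | add s t hs ht => rw [map_add]; exact add_mem hs ht

/-- Both sides are bilinear, and on generators this is the third defining relation. It makes `ker κ`
central, hence `J₂` abelian. -/
theorem lie_eq_tmul (s t : LiePairTensor N) :
    ⁅s, t⁆ = tmul N.actLeft N.actRight (kappa N s) ⟨kappa N t, kappa_mem t⟩ := by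
  induction s using LieTensor.induction_on with
  | add s s' hs hs' => rw [add_lie, hs, hs', map_add, add_tmul]
  | tmul l n =>
    induction t using LieTensor.induction_on with
    | add t t' ht ht' =>
      rw [lie_add, ht, ht', ← tmul_add]
      exact congrArg _ (Subtype.ext (map_add (kappa N) t t').symm)
    | tmul l' n' =>
      rw [lie_tmul_tmul, LieIdeal.actRight_apply, kappa_tmul, ← lie_skew l (n : L)]
      have h : N.actLeft l' n' =
          ⟨kappa N (tmul N.actLeft N.actRight l' n'), kappa_mem _⟩ :=
        Subtype.ext (kappa_tmul N l' n').symm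
      rw [h]
      exact (LinearMap.map_neg₂ (tmulₗ N.actLeft N.actRight) _ _).symm

theorem lie_eq_zero_of_kappa {s : LiePairTensor N} (hs : kappa N s = 0) (t : LiePairTensor N) :
    ⁅s, t⁆ = 0 := by
  rw [lie_eq_tmul, hs, zero_tmul]

end LiePairTensor

theorem lieJ2_lie_eq_zero {L : Type v} [LieRing L] [LieAlgebra F L] {N : LieIdeal F L}
    (s t : lieJ2 N) : ⁅s, t⁆ = 0 :=
  Subtype.ext (LiePairTensor.lie_eq_zero_of_kappa (LieHom.mem_ker.1 s.2) t.1)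

/-- Brackets in the target vanish, so `0` is always a preimage. -/
theorem lieJ2ToProd_isIdealMorphism {L₁ : Type v} [LieRing L₁] [LieAlgebra F L₁] {L₂ : Type w}
    [LieRing L₂] [LieAlgebra F L₂] {N₁ : LieIdeal F L₁} {N₂ : LieIdeal F L₂}
    {N : LieIdeal F (LieFreeProduct F L₁ L₂)}
    (hN : N.toLieSubalgebra = (LieFreeProduct.inclusion N₁ N₂).range) :
    (lieJ2ToProd hN).IsIdealMorphism :=
  (LieHom.isIdealMorphism_iff _).2 fun x y => ⟨0, by rw [lieJ2_lie_eq_zero, map_zero]⟩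

/-- In `N / [N, L]` the bracket is zero. -/
theorem LieIdeal.modLie_lie_eq_zero {L : Type v} [LieRing L] [LieAlgebra F L] (N : LieIdeal F L)
    (x y : N.modLie) : ⁅x, y⁆ = 0 := by
  obtain ⟨x, rfl⟩ := LieSubmodule.Quotient.surjective_mk' _ x
  obtain ⟨y, rfl⟩ := LieSubmodule.Quotient.surjective_mk' _ y
  refine (LieSubmodule.Quotient.mk_eq_zero _ (m := ⁅x, y⁆)).2 ?_
  change ⁅(x : L), (y : L)⁆ ∈ ⁅N, (⊤ : LieIdeal F L)⁆
  exact LieSubmodule.lie_mem_lie x.2 (LieSubmodule.mem_top _)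

/-- A linear isomorphism of `J₂(L₁ ⊕ L₂, N₁ ⊕ N₂) / J₂(L₁ * L₂, N₁ * N₂)` with a tensor product is
an isomorphism of Lie algebras, as all brackets are zero. -/
theorem nonempty_lieEquiv_of_linearEquiv {L₁ : Type v} [LieRing L₁] [LieAlgebra F L₁] {L₂ : Type w}
    [LieRing L₂] [LieAlgebra F L₂] {N₁ : LieIdeal F L₁} {N₂ : LieIdeal F L₂}
    {N : LieIdeal F (LieFreeProduct F L₁ L₂)}
    (hN : N.toLieSubalgebra = (LieFreeProduct.inclusion N₁ N₂).range)
    (e : (lieJ2 (lieIdealProd N₁ N₂) ⧸ (lieJ2ToProd hN).idealRange) ≃ₗ[F]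
      N₁.modLie ⊗[F] N₂.modLie) :
    Nonempty ((lieJ2 (lieIdealProd N₁ N₂) ⧸ (lieJ2ToProd hN).idealRange) ≃ₗ⁅F⁆
      LieTensor (0 : N₁.modLie →ₗ⁅F⁆ LieDerivation F N₂.modLie N₂.modLie)
        (0 : N₂.modLie →ₗ⁅F⁆ LieDerivation F N₁.modLie N₁.modLie)) := by
  let e' := e.trans
    (LieTensor.equivTensorProduct N₁.modLie_lie_eq_zero N₂.modLie_lie_eq_zero).symm
  refine ⟨{ e' with map_lie' := fun {x y} => ?_ }⟩
  change e' ⁅x, y⁆ = ⁅e' x, e' y⁆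
  rw [LieTensor.lie_eq_zero_of_trivial]
  obtain ⟨x, rfl⟩ := LieSubmodule.Quotient.surjective_mk' _ x
  obtain ⟨y, rfl⟩ := LieSubmodule.Quotient.surjective_mk' _ y
  have h : ⁅LieSubmodule.Quotient.mk' (lieJ2ToProd hN).idealRange x,
      LieSubmodule.Quotient.mk' (lieJ2ToProd hN).idealRange y⁆ =
      LieSubmodule.Quotient.mk' (lieJ2ToProd hN).idealRange ⁅x, y⁆ := rfl
  rw [h, lieJ2_lie_eq_zero, map_zero, map_zero]

end TensorLinear

/-! ### Cocycles on a free product -/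

section Cocycle

/-- A linear map which kills the kernel of another one factors through it. -/
theorem LinearMap.exists_comp_eq_of_ker_le {K U V W : Type*} [Field K] [AddCommGroup U]
    [Module K U] [AddCommGroup V] [Module K V] [AddCommGroup W] [Module K W] (f : U →ₗ[K] V)
    (g : U →ₗ[K] W) (h : ∀ x, f x = 0 → g x = 0) : ∃ c : V →ₗ[K] W, ∀ x, c (f x) = g x := by
  obtain ⟨i, hi⟩ := LinearMap.exists_leftInverse_of_injective
    ((LinearMap.ker f).liftQ f le_rfl) (Submodule.ker_liftQ_eq_bot' _ f rfl)
  refine ⟨(LinearMap.ker f).liftQ g (fun x hx => h x hx) ∘ₗ i, fun x => ?_⟩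
  have := LinearMap.congr_fun hi (Submodule.Quotient.mk x)
  simp only [LinearMap.comp_apply, Submodule.liftQ_apply, LinearMap.id_apply] at this
  rw [LinearMap.comp_apply, this]
  rfl

variable {F : Type u} [CommRing F]

/-- The Lie ring structure on `L × V` given by an alternating bilinear 2-cocycle. -/
abbrev cocycleLieRing {L V : Type*} [LieRing L] [LieAlgebra F L] [AddCommGroup V] [Module F V]
    (ω : L →ₗ[F] L →ₗ[F] V) (h₀ : ∀ x, ω x x = 0)
    (h₁ : ∀ x y z, ω x ⁅y, z⁆ = ω ⁅x, y⁆ z + ω y ⁅x, z⁆) : LieRing (L × V) where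
  bracket e e' := (⁅e.1, e'.1⁆, ω e.1 e'.1)
  add_lie x y z := by ext <;> simp
  lie_add x y z := by ext <;> simp
  lie_self x := by ext <;> simp [h₀]
  leibniz_lie x y z := Prod.ext (leibniz_lie x.1 y.1 z.1) (h₁ x.1 y.1 z.1)

variable {L₁ : Type v} [LieRing L₁] [LieAlgebra F L₁]
variable {L₂ : Type w} [LieRing L₂] [LieAlgebra F L₂]

namespace LieFreeProduct

/-- A 2-cocycle on a free product whose restrictions to both factors are coboundaries is a
coboundary. -/
theorem exists_primitive {V : Type*} [AddCommGroup V] [Module F V]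
    (ω : LieFreeProduct F L₁ L₂ →ₗ[F] LieFreeProduct F L₁ L₂ →ₗ[F] V) (h₀ : ∀ x, ω x x = 0)
    (h₁ : ∀ x y z, ω x ⁅y, z⁆ = ω ⁅x, y⁆ z + ω y ⁅x, z⁆)
    (c₁ : L₁ →ₗ[F] V) (hc₁ : ∀ x y, c₁ ⁅x, y⁆ = ω (inl F L₁ L₂ x) (inl F L₁ L₂ y))
    (c₂ : L₂ →ₗ[F] V) (hc₂ : ∀ x y, c₂ ⁅x, y⁆ = ω (inr F L₁ L₂ x) (inr F L₁ L₂ y)) :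
    ∃ c : LieFreeProduct F L₁ L₂ →ₗ[F] V, ∀ x y, c ⁅x, y⁆ = ω x y := by
  -- In the central extension by `ω`, the hypotheses on `c₁` and `c₂` say that `x ↦ (x, cᵢ x)` are
  -- homomorphisms on the factors. The universal property glues them to a section, whose
  -- `V`-component is the primitive.
  let _ : LieRing (LieFreeProduct F L₁ L₂ × V) := cocycleLieRing ω h₀ h₁
  let _ : LieAlgebra F (LieFreeProduct F L₁ L₂ × V) :=
    { (inferInstance : Module F (LieFreeProduct F L₁ L₂ × V)) with
      lie_smul := fun c x y => Prod.ext (lie_smul c x.1 y.1) (map_smul (ω x.1) c y.1) }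
  let s₁ : L₁ →ₗ⁅F⁆ LieFreeProduct F L₁ L₂ × V :=
    { (inl F L₁ L₂ : L₁ →ₗ[F] LieFreeProduct F L₁ L₂).prod c₁ with
      map_lie' := fun {x y} => Prod.ext ((inl F L₁ L₂).map_lie x y) (hc₁ x y) }
  let s₂ : L₂ →ₗ⁅F⁆ LieFreeProduct F L₁ L₂ × V :=
    { (inr F L₁ L₂ : L₂ →ₗ[F] LieFreeProduct F L₁ L₂).prod c₂ with
      map_lie' := fun {x y} => Prod.ext ((inr F L₁ L₂).map_lie x y) (hc₂ x y) }
  let p : LieFreeProduct F L₁ L₂ × V →ₗ⁅F⁆ LieFreeProduct F L₁ L₂ :=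
    { LinearMap.fst F (LieFreeProduct F L₁ L₂) V with map_lie' := fun {_ _} => rfl }
  have hp : p.comp (lift s₁ s₂) = LieHom.id := by
    apply hom_ext
    · intro x
      change p (lift s₁ s₂ (inl F L₁ L₂ x)) = _
      rw [lift_inl]
      rfl
    · intro x
      change p (lift s₁ s₂ (inr F L₁ L₂ x)) = _
      rw [lift_inr]
      rfl
  refine ⟨LinearMap.snd F _ V ∘ₗ (lift s₁ s₂ : LieFreeProduct F L₁ L₂ →ₗ[F] LieFreeProduct F L₁ L₂ × V), fun x y => ?_⟩
  change (lift s₁ s₂ ⁅x, y⁆).2 = _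
  rw [LieHom.map_lie]
  change ω (p (lift s₁ s₂ x)) (p (lift s₁ s₂ y)) = _
  exact congrArg₂ (fun a b => ω a b) (LieHom.congr_fun hp x) (LieHom.congr_fun hp y)

/-- A subalgebra of the free product which contains both factors is everything. -/
theorem mem_of_subalgebra (S : LieSubalgebra F (LieFreeProduct F L₁ L₂))
    (h₁ : ∀ x, inl F L₁ L₂ x ∈ S) (h₂ : ∀ x, inr F L₁ L₂ x ∈ S) (z : LieFreeProduct F L₁ L₂) :
    z ∈ S := by
  let f : L₁ →ₗ⁅F⁆ S :=
    { (inl F L₁ L₂ : L₁ →ₗ[F] LieFreeProduct F L₁ L₂).codRestrict S.toSubmodule h₁ with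
      map_lie' := fun {x y} => Subtype.ext ((inl F L₁ L₂).map_lie x y) }
  let g : L₂ →ₗ⁅F⁆ S :=
    { (inr F L₁ L₂ : L₂ →ₗ[F] LieFreeProduct F L₁ L₂).codRestrict S.toSubmodule h₂ with
      map_lie' := fun {x y} => Subtype.ext ((inr F L₁ L₂).map_lie x y) }
  have h : S.incl.comp (lift f g) = LieHom.id := by
    apply hom_ext
    · intro x
      change ((lift f g (inl F L₁ L₂ x) : S) : LieFreeProduct F L₁ L₂) = _
      rw [lift_inl]
      rfl
    · intro x
      change ((lift f g (inr F L₁ L₂ x) : S) : LieFreeProduct F L₁ L₂) = _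
      rw [lift_inr]
      rfl
  have hz := LieHom.congr_fun h z
  change ((lift f g z : S) : LieFreeProduct F L₁ L₂) = z at hz
  rw [← hz]
  exact (lift f g z).2

end LieFreeProduct

end Cocycle

/-! ### Nonabelian tensor squares -/

section Square

variable {F : Type u} [CommRing F] {L : Type v} [LieRing L] [LieAlgebra F L]

namespace LiePairTensor

open LieTensor

variable {N : LieIdeal F L} (hN : ∀ x, x ∈ N)

/-- The bilinear map `(l, l') ↦ l ⊗ l'`, if the ideal is everything. -/
def sq : L →ₗ[F] L →ₗ[F] LiePairTensor N :=
  (tmulₗ N.actLeft N.actRight).compl₂ (LinearMap.id.codRestrict N.toSubmodule hN)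

theorem sq_apply (x y : L) : sq hN x y = tmul N.actLeft N.actRight x ⟨y, hN y⟩ := rfl

@[simp]
theorem kappa_sq (x y : L) : kappa N (sq hN x y) = ⁅x, y⁆ := kappa_tmul _ _ _

theorem lie_sq (x y z : L) : sq hN ⁅x, y⁆ z = sq hN x ⁅y, z⁆ - sq hN y ⁅x, z⁆ :=
  lie_tmul N.actLeft N.actRight x y ⟨z, hN z⟩

theorem sq_lie (x y z : L) : sq hN x ⁅y, z⁆ = sq hN ⁅z, x⁆ y - sq hN ⁅y, x⁆ z := by
  have h := tmul_lie N.actLeft N.actRight x ⟨y, hN y⟩ ⟨z, hN z⟩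
  rwa [LieIdeal.actRight_apply, LieIdeal.actRight_apply] at h

/-- Expanding by the right relation and then by the left one gives `x ⊗ [y, z] = y ⊗ [x, z] - z ⊗
[x, y]`, the negative of the left expansion of `[y, z] ⊗ x`. Hence `x ⊗ y + y ⊗ x` depends only on
classes modulo commutators. -/
theorem sq_lie_add_lie_sq (x y z : L) : sq hN x ⁅y, z⁆ + sq hN ⁅y, z⁆ x = 0 := by
  have h₁ := sq_lie hN x y z
  have h₂ := lie_sq hN z x y
  have h₃ := lie_sq hN y x z
  have h₄ := lie_sq hN y z x
  rw [h₂, h₃, ← lie_skew z y] at h₁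
  rw [h₄, ← lie_skew z x, ← lie_skew y x]
  simp only [map_neg] at h₁ ⊢
  rw [← sub_eq_zero] at h₁
  rw [← neg_eq_zero, ← h₁]
  abel

theorem sq_kappa_add (x : L) (t : LiePairTensor N) :
    sq hN x (kappa N t) + sq hN (kappa N t) x = 0 := by
  induction t using LieTensor.induction_on with
  | tmul l n => rw [kappa_tmul, sq_lie_add_lie_sq]
  | add s t hs ht =>
    rw [map_add, map_add, map_add, LinearMap.add_apply, add_add_add_comm, hs, ht, add_zero]

/-- In characteristic 2 this does not follow from `sq_kappa_add`; it comes from `[t, t] = 0`. -/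
theorem sq_kappa_self (t : LiePairTensor N) : sq hN (kappa N t) (kappa N t) = 0 := by
  rw [sq_apply, ← lie_eq_tmul, lie_self]

@[elab_as_elim]
theorem sq_induction {p : LiePairTensor N → Prop} (t : LiePairTensor N)
    (sq : ∀ x y, p (sq hN x y)) (add : ∀ s t, p s → p t → p (s + t)) : p t :=
  LieTensor.induction_on t (fun l n => sq l n) add

theorem map_sq {L' : Type w} [LieRing L'] [LieAlgebra F L'] {N' : LieIdeal F L'}
    (hN' : ∀ x, x ∈ N') (f : L →ₗ⁅F⁆ L') (h : ∀ x ∈ N, f x ∈ N') (x y : L) :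
    map f h (sq hN x y) = sq hN' (f x) (f y) := map_tmul _ _ _ _

end LiePairTensor

end Square

/-! ### The tensor square of a free product -/

section FreeProductSquare

open LieFreeProduct LiePairTensor

variable {F : Type u} [Field F] {L₁ : Type v} [LieRing L₁] [LieAlgebra F L₁]
variable {L₂ : Type w} [LieRing L₂] [LieAlgebra F L₂]
variable {N₁ : LieIdeal F L₁} {N₂ : LieIdeal F L₂} {N : LieIdeal F (LieFreeProduct F L₁ L₂)}

/-- Modulo commutators, every element of the free product is a sum of elements of the factors. -/
theorem LieFreeProduct.exists_eq_add_kappa (h : ∀ x, x ∈ N) (z : LieFreeProduct F L₁ L₂) :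
    ∃ x y t, z = inl F L₁ L₂ x + inr F L₁ L₂ y + kappa N t := by
  let S : LieSubalgebra F (LieFreeProduct F L₁ L₂) :=
    { LinearMap.range (((inl F L₁ L₂ : L₁ →ₗ[F] LieFreeProduct F L₁ L₂).coprod
        (inr F L₁ L₂ : L₂ →ₗ[F] LieFreeProduct F L₁ L₂)).coprod
          (kappa N : LiePairTensor N →ₗ[F] LieFreeProduct F L₁ L₂)) with
      lie_mem' := fun {a b} _ _ => ⟨((0, 0), sq h a b), by simp⟩ }
  obtain ⟨⟨⟨x, y⟩, t⟩, hz⟩ := mem_of_subalgebra S (fun x => ⟨((x, 0), 0), by simp⟩)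
    (fun x => ⟨((0, x), 0), by simp⟩) z
  exact ⟨x, y, t, by rw [← hz]; simp⟩

/-- The form `q (x ⊗ y)` is an alternating 2-cocycle, the cocycle identity being the left relation.
By `hq₁` and `hq₂` its restrictions to the factors factor through `κ`, so they are coboundaries;
`exists_primitive` then gives `q = c ∘ κ`. -/
theorem LieFreeProduct.apply_eq_zero_of_kappa {V : Type*} [AddCommGroup V] [Module F V]
    (h : ∀ x, x ∈ N) (h₁ : ∀ x, x ∈ N₁) (h₂ : ∀ x, x ∈ N₂) (q : LiePairTensor N →ₗ[F] V)
    (hq₁ : ∀ t, kappa N₁ t = 0 → q (map (inl F L₁ L₂) (fun _ _ => h _) t) = 0)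
    (hq₂ : ∀ t, kappa N₂ t = 0 → q (map (inr F L₁ L₂) (fun _ _ => h _) t) = 0)
    (hq : ∀ x y, q (sq h (inl F L₁ L₂ x) (inr F L₁ L₂ y)) +
      q (sq h (inr F L₁ L₂ y) (inl F L₁ L₂ x)) = 0)
    {t : LiePairTensor N} (ht : kappa N t = 0) : q t = 0 := by
  -- With `z = x + y + κ t`, the squares of `x` and `y` come from `J₂` of the factors, the cross
  -- terms of `x` and `y` cancel by `hq`, and all terms with `κ t` cancel or vanish.
  have h₀ : ∀ z, q (sq h z z) = 0 := by
    intro z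
    obtain ⟨x, y, t, rfl⟩ := exists_eq_add_kappa h z
    have hx : q (sq h (inl F L₁ L₂ x) (inl F L₁ L₂ x)) = 0 := by
      rw [← map_sq h₁ h _ (fun _ _ => h _)]
      exact hq₁ _ (by simp)
    have hy : q (sq h (inr F L₁ L₂ y) (inr F L₁ L₂ y)) = 0 := by
      rw [← map_sq h₂ h _ (fun _ _ => h _)]
      exact hq₂ _ (by simp)
    have hxt := congrArg q (sq_kappa_add h (inl F L₁ L₂ x) t)
    have hyt := congrArg q (sq_kappa_add h (inr F L₁ L₂ y) t)
    simp only [map_add, map_zero] at hxt hyt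
    simp only [map_add, LinearMap.add_apply, hx, hy, sq_kappa_self, zero_add, add_zero]
    have hs := congrArg₂ (· + ·) (hq x y) (congrArg₂ (· + ·) hxt hyt)
    simp only [add_zero] at hs
    rw [← hs]
    abel
  let i₁ : LiePairTensor N₁ →ₗ[F] LiePairTensor N :=
    (map (inl F L₁ L₂) (fun _ _ => h _) : LiePairTensor N₁ →ₗ⁅F⁆ LiePairTensor N)
  obtain ⟨c₁, hc₁⟩ := LinearMap.exists_comp_eq_of_ker_le
    (kappa N₁ : LiePairTensor N₁ →ₗ[F] L₁)
    (q ∘ₗ i₁) hq₁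
  let i₂ : LiePairTensor N₂ →ₗ[F] LiePairTensor N :=
    (map (inr F L₁ L₂) (fun _ _ => h _) : LiePairTensor N₂ →ₗ⁅F⁆ LiePairTensor N)
  obtain ⟨c₂, hc₂⟩ := LinearMap.exists_comp_eq_of_ker_le
    (kappa N₂ : LiePairTensor N₂ →ₗ[F] L₂)
    (q ∘ₗ i₂) hq₂
  obtain ⟨c, hc⟩ := exists_primitive ((sq h).compr₂ q) h₀
    (fun x y z => by
      simp only [LinearMap.compr₂_apply, lie_sq, map_sub, sub_add_cancel])
    c₁ (fun x y => by
      have := hc₁ (sq h₁ x y)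
      change c₁ (kappa N₁ (sq h₁ x y)) = q (map _ _ (sq h₁ x y)) at this
      rw [kappa_sq, map_sq h₁ h] at this
      exact this)
    c₂ (fun x y => by
      have := hc₂ (sq h₂ x y)
      change c₂ (kappa N₂ (sq h₂ x y)) = q (map _ _ (sq h₂ x y)) at this
      rw [kappa_sq, map_sq h₂ h] at this
      exact this)
  have hcq : ∀ t, c (kappa N t) = q t := by
    intro t
    induction t using sq_induction h with
    | sq x y => rw [kappa_sq, hc]; rfl
    | add s t hs ht => rw [map_add, map_add, map_add, hs, ht]
  rw [← hcq, ht, map_zero]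

end FreeProductSquare

/-! ### Bilinear maps on `N₁ / [N₁, L₁]` and `N₂ / [N₂, L₂]` -/

section ModLie

variable {F : Type u} [CommRing F] {L : Type v} [LieRing L] [LieAlgebra F L]

/-- The projection `L → N / [N, L]`, if the ideal `N` is everything. -/
def LieIdeal.toModLie {N : LieIdeal F L} (h : ∀ x, x ∈ N) : L →ₗ[F] N.modLie :=
  (LieIdeal.comap N.incl ⁅N, (⊤ : LieIdeal F L)⁆).toSubmodule.mkQ ∘ₗ
    LinearMap.id.codRestrict N.toSubmodule h

theorem LieIdeal.toModLie_surjective {N : LieIdeal F L} (h : ∀ x, x ∈ N) :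
    Function.Surjective (LieIdeal.toModLie h) := by
  intro y
  obtain ⟨x, rfl⟩ := Submodule.mkQ_surjective _ y
  exact ⟨x, rfl⟩

@[simp]
theorem LieIdeal.toModLie_lie {N : LieIdeal F L} (h : ∀ x, x ∈ N) (x y : L) :
    LieIdeal.toModLie h ⁅x, y⁆ = 0 :=
  (Submodule.Quotient.mk_eq_zero _).2
    (LieSubmodule.lie_mem_lie (h x) (LieSubmodule.mem_top y) : ⁅x, y⁆ ∈ ⁅N, (⊤ : LieIdeal F L)⁆)

theorem LieIdeal.apply_eq_zero_of_mem {V : Type*} [AddCommGroup V] [Module F V]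
    {N : LieIdeal F L} (f : L →ₗ[F] V) (hf : ∀ x y : L, f ⁅x, y⁆ = 0) (x : N)
    (hx : x ∈ LieIdeal.comap N.incl ⁅N, (⊤ : LieIdeal F L)⁆) : f x = 0 := by
  have hx' : (x : L) ∈ (⁅N, (⊤ : LieIdeal F L)⁆ : LieIdeal F L).toSubmodule := hx
  rw [LieSubmodule.lieIdeal_oper_eq_linear_span] at hx'
  refine (Submodule.span_le (p := LinearMap.ker f)).2 ?_ hx'
  rintro _ ⟨a, b, rfl⟩
  exact hf _ _

variable {L₁ : Type v} [LieRing L₁] [LieAlgebra F L₁]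
variable {L₂ : Type w} [LieRing L₂] [LieAlgebra F L₂]
variable {N₁ : LieIdeal F L₁} {N₂ : LieIdeal F L₂}

theorem exists_tensor_modLie_lift {V : Type*} [AddCommGroup V] [Module F V]
    (h₁ : ∀ x, x ∈ N₁) (h₂ : ∀ x, x ∈ N₂) (β : L₁ →ₗ[F] L₂ →ₗ[F] V)
    (hβ₁ : ∀ (x x' : L₁) y, β ⁅x, x'⁆ y = 0) (hβ₂ : ∀ x (y y' : L₂), β x ⁅y, y'⁆ = 0) :
    ∃ θ : N₁.modLie ⊗[F] N₂.modLie →ₗ[F] V,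
      ∀ x y, θ (LieIdeal.toModLie h₁ x ⊗ₜ LieIdeal.toModLie h₂ y) = β x y := by
  let γ : L₁ →ₗ[F] N₂.modLie →ₗ[F] V :=
    ((LieIdeal.comap N₂.incl ⁅N₂, (⊤ : LieIdeal F L₂)⁆).toSubmodule.liftQ
      (β.flip ∘ₗ N₂.toSubmodule.subtype)
      fun y hy => LieIdeal.apply_eq_zero_of_mem β.flip
        (fun y y' => LinearMap.ext fun x => hβ₂ x y y') y hy).flip
  have hγ : ∀ x y, γ x (LieIdeal.toModLie h₂ y) = β x y := fun _ _ => rfl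
  let δ : N₁.modLie →ₗ[F] N₂.modLie →ₗ[F] V :=
    (LieIdeal.comap N₁.incl ⁅N₁, (⊤ : LieIdeal F L₁)⁆).toSubmodule.liftQ
      (γ ∘ₗ N₁.toSubmodule.subtype) fun x hx => LieIdeal.apply_eq_zero_of_mem γ
        (fun x x' => LinearMap.ext fun y => by
          obtain ⟨y, rfl⟩ := LieIdeal.toModLie_surjective h₂ y
          rw [hγ, hβ₁, LinearMap.zero_apply]) x hx
  exact ⟨TensorProduct.lift δ, fun x y => rfl⟩

theorem tensor_modLie_ext {V : Type*} [AddCommGroup V] [Module F V]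
    (h₁ : ∀ x, x ∈ N₁) (h₂ : ∀ x, x ∈ N₂) {f g : N₁.modLie ⊗[F] N₂.modLie →ₗ[F] V}
    (h : ∀ x y, f (LieIdeal.toModLie h₁ x ⊗ₜ LieIdeal.toModLie h₂ y) =
      g (LieIdeal.toModLie h₁ x ⊗ₜ LieIdeal.toModLie h₂ y)) : f = g := by
  refine TensorProduct.ext' fun x y => ?_
  obtain ⟨x, rfl⟩ := LieIdeal.toModLie_surjective h₁ x
  obtain ⟨y, rfl⟩ := LieIdeal.toModLie_surjective h₂ y
  exact h x y

end ModLie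

/-! ### Comparison of the tensor squares of `L₁ * L₂` and `L₁ ⊕ L₂` -/

section Comparison

open LieFreeProduct LiePairTensor

variable {F : Type u} [Field F] {L₁ : Type v} [LieRing L₁] [LieAlgebra F L₁]
variable {L₂ : Type w} [LieRing L₂] [LieAlgebra F L₂]
variable {N₁ : LieIdeal F L₁} {N₂ : LieIdeal F L₂} {N : LieIdeal F (LieFreeProduct F L₁ L₂)}

@[simp]
theorem LieFreeProduct.toProd_inl (x : L₁) : toProd F L₁ L₂ (inl F L₁ L₂ x) = (x, 0) :=
  lift_inl _ _ _

@[simp]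
theorem LieFreeProduct.toProd_inr (x : L₂) : toProd F L₁ L₂ (inr F L₁ L₂ x) = (0, x) :=
  lift_inr _ _ _

theorem LiePairTensor.linearMap_ext_sq {L : Type*} [LieRing L] [LieAlgebra F L] {M : LieIdeal F L}
    (hM : ∀ x, x ∈ M) {V : Type*} [AddCommGroup V] [Module F V] {f g : LiePairTensor M →ₗ[F] V}
    (h : ∀ x y, f (sq hM x y) = g (sq hM x y)) : f = g :=
  LieTensor.linearMap_ext fun l n => h l n

/-- The symmetric map `x ⊗ y ↦ x ⊗ y + y ⊗ x` into the tensor square of the free product. -/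
theorem exists_symm_modLie_lift (h : ∀ z, z ∈ N) (h₁ : ∀ x, x ∈ N₁) (h₂ : ∀ x, x ∈ N₂) :
    ∃ θ : N₁.modLie ⊗[F] N₂.modLie →ₗ[F] LiePairTensor N,
      ∀ x y, θ (LieIdeal.toModLie h₁ x ⊗ₜ LieIdeal.toModLie h₂ y) =
        sq h (inl F L₁ L₂ x) (inr F L₁ L₂ y) + sq h (inr F L₁ L₂ y) (inl F L₁ L₂ x) := by
  let j₁ : L₁ →ₗ[F] LieFreeProduct F L₁ L₂ := inl F L₁ L₂
  let j₂ : L₂ →ₗ[F] LieFreeProduct F L₁ L₂ := inr F L₁ L₂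
  refine exists_tensor_modLie_lift h₁ h₂
    ((sq h).compl₁₂ j₁ j₂ + ((sq h).compl₁₂ j₂ j₁).flip) (fun x x' y => ?_) (fun x y y' => ?_)
  · change sq h (inl F L₁ L₂ ⁅x, x'⁆) (inr F L₁ L₂ y) +
      sq h (inr F L₁ L₂ y) (inl F L₁ L₂ ⁅x, x'⁆) = 0
    rw [LieHom.map_lie, add_comm, sq_lie_add_lie_sq]
  · change sq h (inl F L₁ L₂ x) (inr F L₁ L₂ ⁅y, y'⁆) +
      sq h (inr F L₁ L₂ ⁅y, y'⁆) (inl F L₁ L₂ x) = 0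
    rw [LieHom.map_lie, sq_lie_add_lie_sq]

/-- As `L₁` and `L₂` commute in the direct sum, the relations turn `[x, x'] ⊗ y` and its analogues
into tensors with a zero factor. -/
theorem exists_prod_modLie_lift (h : ∀ z, z ∈ lieIdealProd N₁ N₂) (h₁ : ∀ x, x ∈ N₁)
    (h₂ : ∀ x, x ∈ N₂) :
    ∃ μ ν : N₁.modLie ⊗[F] N₂.modLie →ₗ[F] LiePairTensor (lieIdealProd N₁ N₂),
      (∀ x y, μ (LieIdeal.toModLie h₁ x ⊗ₜ LieIdeal.toModLie h₂ y) = sq h (x, 0) (0, y)) ∧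
      (∀ x y, ν (LieIdeal.toModLie h₁ x ⊗ₜ LieIdeal.toModLie h₂ y) = sq h (0, y) (x, 0)) := by
  have e₁ (x x' : L₁) : ((⁅x, x'⁆, 0) : L₁ × L₂) = ⁅((x, 0) : L₁ × L₂), (x', 0)⁆ := by
    simp
  have e₂ (y y' : L₂) : ((0, ⁅y, y'⁆) : L₁ × L₂) = ⁅((0, y) : L₁ × L₂), (0, y')⁆ := by
    simp
  have e (x : L₁) (y : L₂) : ⁅((x, 0) : L₁ × L₂), ((0, y) : L₁ × L₂)⁆ = 0 := by simp
  have e' (x : L₁) (y : L₂) : ⁅((0, y) : L₁ × L₂), ((x, 0) : L₁ × L₂)⁆ = 0 := by simp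
  obtain ⟨μ, hμ⟩ := exists_tensor_modLie_lift h₁ h₂
    ((sq h).compl₁₂ (LinearMap.inl F L₁ L₂) (LinearMap.inr F L₁ L₂))
    (fun x x' y => by
      change sq h (⁅x, x'⁆, 0) (0, y) = 0
      rw [e₁, lie_sq, e, e, map_zero, map_zero, sub_zero])
    (fun x y y' => by
      change sq h (x, 0) (0, ⁅y, y'⁆) = 0
      rw [e₂, sq_lie, e', e', map_zero, LinearMap.zero_apply, LinearMap.zero_apply, sub_zero])
  obtain ⟨ν, hν⟩ := exists_tensor_modLie_lift h₁ h₂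
    ((sq h).compl₁₂ (LinearMap.inr F L₁ L₂) (LinearMap.inl F L₁ L₂)).flip
    (fun x x' y => by
      change sq h (0, y) (⁅x, x'⁆, 0) = 0
      rw [e₁, sq_lie, e, e, map_zero, LinearMap.zero_apply, LinearMap.zero_apply, sub_zero])
    (fun x y y' => by
      change sq h (0, ⁅y, y'⁆) (x, 0) = 0
      rw [e₂, lie_sq, e', e', map_zero, map_zero, sub_zero])
  exact ⟨μ, ν, hμ, hν⟩

/-- The coordinates opposite to `μ` and `ν`. They respect the defining relations because every term
there contains a commutator, which dies in `N₁ / [N₁, L₁]` or `N₂ / [N₂, L₂]`. -/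
theorem exists_mixed_parts (h : ∀ z, z ∈ lieIdealProd N₁ N₂) (h₁ : ∀ x, x ∈ N₁)
    (h₂ : ∀ x, x ∈ N₂) :
    ∃ ψ ψ' : LiePairTensor (lieIdealProd N₁ N₂) →ₗ[F] N₁.modLie ⊗[F] N₂.modLie,
      (∀ x y, ψ (sq h x y) = LieIdeal.toModLie h₁ x.1 ⊗ₜ LieIdeal.toModLie h₂ y.2) ∧
      (∀ x y, ψ' (sq h x y) = LieIdeal.toModLie h₁ y.1 ⊗ₜ LieIdeal.toModLie h₂ x.2) := by
  let f : L₁ × L₂ →ₗ[F] N₁.modLie := LieIdeal.toModLie h₁ ∘ₗ LinearMap.fst F L₁ L₂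
  let g : L₁ × L₂ →ₗ[F] N₂.modLie := LieIdeal.toModLie h₂ ∘ₗ LinearMap.snd F L₁ L₂
  have hf (x y : L₁ × L₂) : f ⁅x, y⁆ = 0 := LieIdeal.toModLie_lie h₁ x.1 y.1
  have hg (x y : L₁ × L₂) : g ⁅x, y⁆ = 0 := LieIdeal.toModLie_lie h₂ x.2 y.2
  let ι : lieIdealProd N₁ N₂ →ₗ[F] L₁ × L₂ := (lieIdealProd N₁ N₂).toSubmodule.subtype
  have hl (x : L₁ × L₂) (n : lieIdealProd N₁ N₂) :
      ι ((lieIdealProd N₁ N₂).actLeft x n) = ⁅x, (n : L₁ × L₂)⁆ := rfl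
  have hb (n n' : lieIdealProd N₁ N₂) : ι ⁅n, n'⁆ = ⁅(n : L₁ × L₂), (n' : L₁ × L₂)⁆ := rfl
  refine ⟨LieTensor.liftLinear ((TensorProduct.mk F _ _).compl₁₂ f (g ∘ₗ ι))
      (fun l l' n => ?_) (fun l n n' => ?_) (fun l l' n n' => ?_),
    LieTensor.liftLinear ((TensorProduct.mk F _ _).flip.compl₁₂ g (f ∘ₗ ι))
      (fun l l' n => ?_) (fun l n n' => ?_) (fun l l' n n' => ?_),
    fun x y => LieTensor.liftLinear_tmul _ _ _ _ _ _,
    fun x y => LieTensor.liftLinear_tmul _ _ _ _ _ _⟩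
  all_goals simp only [LinearMap.compl₁₂_apply, LinearMap.comp_apply, TensorProduct.mk_apply,
    LinearMap.flip_apply, hf, hg, hl, hb, LieIdeal.actRight_apply, TensorProduct.zero_tmul,
    TensorProduct.tmul_zero, sub_zero]

/-- The case of the main theorem in which both ideals are everything. -/
theorem lieJ2ToProd_of_full (hN : N.toLieSubalgebra = (inclusion N₁ N₂).range)
    (h₁ : ∀ x, x ∈ N₁) (h₂ : ∀ x, x ∈ N₂) :
    Function.Injective (lieJ2ToProd hN) ∧
    Nonempty ((lieJ2 (lieIdealProd N₁ N₂) ⧸ (lieJ2ToProd hN).idealRange) ≃ₗ[F]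
      N₁.modLie ⊗[F] N₂.modLie) := by
  have h : ∀ z, z ∈ N := mem_of_subalgebra N.toLieSubalgebra (fun x => inl_mem hN (h₁ x))
    (fun x => inr_mem hN (h₂ x))
  have hP : ∀ z, z ∈ lieIdealProd N₁ N₂ := fun z => ⟨h₁ z.1, h₂ z.2⟩
  let φ : LiePairTensor N →ₗ[F] LiePairTensor (lieIdealProd N₁ N₂) :=
    (map (toProd F L₁ L₂) (toProd_mem hN) :
      LiePairTensor N →ₗ⁅F⁆ LiePairTensor (lieIdealProd N₁ N₂))
  let i₁ : LiePairTensor N₁ →ₗ[F] LiePairTensor N :=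
    (map (inl F L₁ L₂) (fun _ _ => h _) : LiePairTensor N₁ →ₗ⁅F⁆ LiePairTensor N)
  let i₂ : LiePairTensor N₂ →ₗ[F] LiePairTensor N :=
    (map (inr F L₁ L₂) (fun _ _ => h _) : LiePairTensor N₂ →ₗ⁅F⁆ LiePairTensor N)
  let p₁ : LiePairTensor (lieIdealProd N₁ N₂) →ₗ[F] LiePairTensor N₁ :=
    (map (LieHom.fst F L₁ L₂) (fun _ _ => h₁ _) :
      LiePairTensor (lieIdealProd N₁ N₂) →ₗ⁅F⁆ LiePairTensor N₁)
  let p₂ : LiePairTensor (lieIdealProd N₁ N₂) →ₗ[F] LiePairTensor N₂ :=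
    (map (LieHom.snd F L₁ L₂) (fun _ _ => h₂ _) :
      LiePairTensor (lieIdealProd N₁ N₂) →ₗ⁅F⁆ LiePairTensor N₂)
  have hφ : ∀ x y, φ (sq h x y) = sq hP (toProd F L₁ L₂ x) (toProd F L₁ L₂ y) := map_sq h hP _ _
  have hi₁ : ∀ x y, i₁ (sq h₁ x y) = sq h (inl F L₁ L₂ x) (inl F L₁ L₂ y) := map_sq h₁ h _ _
  have hi₂ : ∀ x y, i₂ (sq h₂ x y) = sq h (inr F L₁ L₂ x) (inr F L₁ L₂ y) := map_sq h₂ h _ _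
  have hp₁ : ∀ x y, p₁ (sq hP x y) = sq h₁ x.1 y.1 := map_sq hP h₁ _ _
  have hp₂ : ∀ x y, p₂ (sq hP x y) = sq h₂ x.2 y.2 := map_sq hP h₂ _ _
  have hκi₁ : ∀ t, kappa N (i₁ t) = inl F L₁ L₂ (kappa N₁ t) := kappa_map _ _
  have hκi₂ : ∀ t, kappa N (i₂ t) = inr F L₁ L₂ (kappa N₂ t) := kappa_map _ _
  have hκp₁ : ∀ t, kappa N₁ (p₁ t) = (kappa (lieIdealProd N₁ N₂) t).1 := kappa_map _ _
  have hκp₂ : ∀ t, kappa N₂ (p₂ t) = (kappa (lieIdealProd N₁ N₂) t).2 := kappa_map _ _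
  obtain ⟨θ, hθ⟩ := exists_symm_modLie_lift h h₁ h₂
  obtain ⟨μ, ν, hμ, hν⟩ := exists_prod_modLie_lift hP h₁ h₂
  obtain ⟨ψ, ψ', hψ, hψ'⟩ := exists_mixed_parts hP h₁ h₂
  have hκθ : ∀ u, kappa N (θ u) = 0 := by
    have : (kappa N : LiePairTensor N →ₗ[F] LieFreeProduct F L₁ L₂) ∘ₗ θ = 0 :=
      tensor_modLie_ext h₁ h₂ fun x y => by
        change kappa N (θ _) = 0
        rw [hθ, map_add, kappa_sq, kappa_sq, ← lie_skew (inl F L₁ L₂ x), neg_add_cancel]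
    exact LinearMap.congr_fun this
  have hκμ : ∀ u, kappa (lieIdealProd N₁ N₂) (μ u) = 0 := by
    have : (kappa (lieIdealProd N₁ N₂) :
        LiePairTensor (lieIdealProd N₁ N₂) →ₗ[F] L₁ × L₂) ∘ₗ μ = 0 :=
      tensor_modLie_ext h₁ h₂ fun x y => by
        change kappa _ (μ _) = 0
        rw [hμ, kappa_sq]
        simp
    exact LinearMap.congr_fun this
  -- the composites of the projections of `P ⊗ P` with the maps into `L ⊗ L`
  have p₁i₁ : ∀ t, p₁ (φ (i₁ t)) = t :=
    LinearMap.congr_fun (f := p₁ ∘ₗ φ ∘ₗ i₁) (g := LinearMap.id) <|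
      linearMap_ext_sq h₁ fun x y => by simp [hi₁, hφ, hp₁]
  have p₁i₂ : ∀ t, p₁ (φ (i₂ t)) = 0 :=
    LinearMap.congr_fun (f := p₁ ∘ₗ φ ∘ₗ i₂) (g := 0) <|
      linearMap_ext_sq h₂ fun x y => by simp [hi₂, hφ, hp₁]
  have p₁θ : ∀ u, p₁ (φ (θ u)) = 0 :=
    LinearMap.congr_fun (f := p₁ ∘ₗ φ ∘ₗ θ) (g := 0) <|
      tensor_modLie_ext h₁ h₂ fun x y => by simp [hθ, hφ, hp₁]
  have p₂i₁ : ∀ t, p₂ (φ (i₁ t)) = 0 :=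
    LinearMap.congr_fun (f := p₂ ∘ₗ φ ∘ₗ i₁) (g := 0) <|
      linearMap_ext_sq h₁ fun x y => by simp [hi₁, hφ, hp₂]
  have p₂i₂ : ∀ t, p₂ (φ (i₂ t)) = t :=
    LinearMap.congr_fun (f := p₂ ∘ₗ φ ∘ₗ i₂) (g := LinearMap.id) <|
      linearMap_ext_sq h₂ fun x y => by simp [hi₂, hφ, hp₂]
  have p₂θ : ∀ u, p₂ (φ (θ u)) = 0 :=
    LinearMap.congr_fun (f := p₂ ∘ₗ φ ∘ₗ θ) (g := 0) <|
      tensor_modLie_ext h₁ h₂ fun x y => by simp [hθ, hφ, hp₂]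
  have ψi₁ : ∀ t, ψ (φ (i₁ t)) = 0 :=
    LinearMap.congr_fun (f := ψ ∘ₗ φ ∘ₗ i₁) (g := 0) <|
      linearMap_ext_sq h₁ fun x y => by simp [hi₁, hφ, hψ]
  have ψi₂ : ∀ t, ψ (φ (i₂ t)) = 0 :=
    LinearMap.congr_fun (f := ψ ∘ₗ φ ∘ₗ i₂) (g := 0) <|
      linearMap_ext_sq h₂ fun x y => by simp [hi₂, hφ, hψ]
  have ψθ : ∀ u, ψ (φ (θ u)) = u :=
    LinearMap.congr_fun (f := ψ ∘ₗ φ ∘ₗ θ) (g := LinearMap.id) <|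
      tensor_modLie_ext h₁ h₂ fun x y => by simp [hθ, hφ, hψ]
  have ψ'i₁ : ∀ t, ψ' (φ (i₁ t)) = 0 :=
    LinearMap.congr_fun (f := ψ' ∘ₗ φ ∘ₗ i₁) (g := 0) <|
      linearMap_ext_sq h₁ fun x y => by simp [hi₁, hφ, hψ']
  have ψ'i₂ : ∀ t, ψ' (φ (i₂ t)) = 0 :=
    LinearMap.congr_fun (f := ψ' ∘ₗ φ ∘ₗ i₂) (g := 0) <|
      linearMap_ext_sq h₂ fun x y => by simp [hi₂, hφ, hψ']
  have ψμ : ∀ u, (ψ - ψ') (μ u) = u :=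
    LinearMap.congr_fun (f := (ψ - ψ') ∘ₗ μ) (g := LinearMap.id) <|
      tensor_modLie_ext h₁ h₂ fun x y => by simp [hμ, hψ, hψ']
  -- Symmetric elements land on the diagonal of the two mixed summands.
  have φθ : ∀ u, φ (θ u) = μ u + ν u :=
    LinearMap.congr_fun (f := φ ∘ₗ θ) (g := μ + ν) <|
      tensor_modLie_ext h₁ h₂ fun x y => by simp [hθ, hμ, hν, hφ]
  have decomp : ∀ t, φ (i₁ (p₁ t)) + φ (i₂ (p₂ t)) + μ (ψ t) + ν (ψ' t) = t :=
    LinearMap.congr_fun (f := φ ∘ₗ i₁ ∘ₗ p₁ + φ ∘ₗ i₂ ∘ₗ p₂ + μ ∘ₗ ψ + ν ∘ₗ ψ')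
      (g := LinearMap.id) <| linearMap_ext_sq hP fun x y => by
      have hx : x = (x.1, 0) + (0, x.2) := by simp
      have hy : y = (y.1, 0) + (0, y.2) := by simp
      conv_rhs => rw [hx, hy]
      simp only [LinearMap.add_apply, LinearMap.comp_apply, hp₁, hp₂, hi₁, hi₂, hφ, hψ, hψ', hμ,
        hν, toProd_inl, toProd_inr, LinearMap.id_apply, map_add]
      abel
  refine ⟨?_, ?_⟩
  · rw [injective_iff_map_eq_zero]
    rintro ⟨t, ht⟩ h0
    have ht' : kappa N t = 0 := ht
    have hφt : φ t = 0 := congrArg Subtype.val h0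
    -- Applying the vanishing criterion to the quotient map by `B` puts `t` in `B`; the coordinates
    -- `p₁`, `p₂`, `ψ` of `φ t` then recover its three components.
    let B : Submodule F (LiePairTensor N) :=
      LinearMap.range ((i₁.coprod i₂).coprod θ)
    have hB : B.mkQ t = 0 := by
      refine apply_eq_zero_of_kappa h h₁ h₂ B.mkQ (fun s _ => ?_) (fun s _ => ?_)
        (fun x y => ?_) ht'
      · exact (Submodule.Quotient.mk_eq_zero B).2 ⟨((s, 0), 0), by simp [i₁]⟩
      · exact (Submodule.Quotient.mk_eq_zero B).2 ⟨((0, s), 0), by simp [i₂]⟩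
      · rw [← map_add, ← hθ]
        exact (Submodule.Quotient.mk_eq_zero B).2 ⟨((0, 0), LieIdeal.toModLie h₁ x ⊗ₜ LieIdeal.toModLie h₂ y), by simp⟩
    obtain ⟨⟨⟨a, b⟩, u⟩, hab⟩ := (Submodule.Quotient.mk_eq_zero B).1 hB
    simp only [LinearMap.coprod_apply] at hab
    have ha : a = 0 := by
      have := congrArg p₁ hφt
      rw [← hab] at this
      simpa only [map_add, map_zero, p₁i₁, p₁i₂, p₁θ, add_zero] using this
    have hb : b = 0 := by
      have := congrArg p₂ hφt
      rw [← hab] at this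
      simpa only [map_add, map_zero, p₂i₁, p₂i₂, p₂θ, add_zero, zero_add] using this
    have hu : u = 0 := by
      have := congrArg ψ hφt
      rw [← hab] at this
      simpa only [map_add, map_zero, ψi₁, ψi₂, ψθ, zero_add] using this
    rw [ha, hb, hu] at hab
    exact Subtype.ext (hab.symm.trans (by simp))
  · let Ψ : lieJ2 (lieIdealProd N₁ N₂) →ₗ[F] N₁.modLie ⊗[F] N₂.modLie :=
      (ψ - ψ') ∘ₗ (lieJ2 (lieIdealProd N₁ N₂)).toSubmodule.subtype
    have hsurj : Function.Surjective Ψ := fun u => ⟨⟨μ u, hκμ u⟩, ψμ u⟩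
    have hker : (lieJ2ToProd hN).idealRange.toSubmodule = LinearMap.ker Ψ := by
      ext ⟨t, ht⟩
      have ht' : kappa (lieIdealProd N₁ N₂) t = 0 := ht
      refine (LieHom.mem_idealRange_iff _ (lieJ2ToProd_isIdealMorphism hN)).trans ⟨?_, ?_⟩
      · rintro ⟨⟨s, hs⟩, hst⟩
        have hst' : φ s = t := congrArg Subtype.val hst
        change (ψ - ψ') t = 0
        rw [← hst']
        -- `ψ` and `ψ'` vanish on the squares of the factors and agree on symmetric elements.
        refine apply_eq_zero_of_kappa h h₁ h₂ ((ψ - ψ') ∘ₗ φ) (fun s _ => ?_) (fun s _ => ?_)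
          (fun x y => ?_) hs
        · change ψ (φ (i₁ s)) - ψ' (φ (i₁ s)) = 0
          rw [ψi₁, ψ'i₁, sub_zero]
        · change ψ (φ (i₂ s)) - ψ' (φ (i₂ s)) = 0
          rw [ψi₂, ψ'i₂, sub_zero]
        · simp [hφ, hψ, hψ']
      · intro h0
        have h0' : ψ t = ψ' t := sub_eq_zero.1 h0
        -- When the two mixed coordinates of `t` agree, `μ (ψ t) + ν (ψ' t)` in `decomp` is `φ (θ (ψ
        -- t))`.
        refine ⟨⟨i₁ (p₁ t) + i₂ (p₂ t) + θ (ψ t), ?_⟩, Subtype.ext ?_⟩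
        · rw [LieHom.mem_ker, map_add, map_add, hκi₁, hκi₂, hκp₁, hκp₂, hκθ, ht']
          simp
        · change φ (i₁ (p₁ t) + i₂ (p₂ t) + θ (ψ t)) = t
          rw [map_add, map_add, φθ, ← add_assoc]
          conv_lhs => enter [2]; rw [h0']
          exact decomp t
    exact ⟨(Submodule.quotEquivOfEq _ _ hker).trans (Ψ.quotKerEquivOfSurjective hsurj)⟩

end Comparison

/-! ### Degenerate cases -/

section Degenerate

open LieFreeProduct LiePairTensor

variable {F : Type u} [Field F]

theorem LiePairTensor.map_map_eq_self {L : Type*} [LieRing L] [LieAlgebra F L] {L' : Type*}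
    [LieRing L'] [LieAlgebra F L'] {N : LieIdeal F L} {N' : LieIdeal F L'} (f : L →ₗ⁅F⁆ L')
    (g : L' →ₗ⁅F⁆ L) (hf : ∀ x ∈ N, f x ∈ N') (hg : ∀ x ∈ N', g x ∈ N) (h : ∀ x, g (f x) = x)
    (t : LiePairTensor N) : map g hg (map f hf t) = t := by
  induction t using LieTensor.induction_on with
  | tmul l n => simp [h]
  | add s t hs ht => rw [map_add, map_add, hs, ht]

theorem LiePairTensor.eq_zero_of_trivial {L : Type*} [LieRing L] [LieAlgebra F L]
    {N : LieIdeal F L} (hN : ∀ x ∈ N, x = 0) (t : LiePairTensor N) : t = 0 := by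
  induction t using LieTensor.induction_on with
  | tmul l n =>
    have hn : n = 0 := Subtype.ext (hN n n.2)
    rw [hn, LieTensor.tmul_zero]
  | add s t hs ht => rw [hs, ht, add_zero]

theorem LieIdeal.modLie_subsingleton {L : Type*} [LieRing L] [LieAlgebra F L]
    {N : LieIdeal F L} (hN : ∀ x ∈ N, x = 0) : Subsingleton N.modLie := by
  refine subsingleton_of_forall_eq 0 fun y => ?_
  obtain ⟨x, rfl⟩ := LieSubmodule.Quotient.surjective_mk' _ y
  have hx : x = 0 := Subtype.ext (hN x x.2)
  rw [hx, map_zero]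

variable {L₁ : Type v} [LieRing L₁] [LieAlgebra F L₁]
variable {L₂ : Type w} [LieRing L₂] [LieAlgebra F L₂]
variable {N₁ : LieIdeal F L₁} {N₂ : LieIdeal F L₂} {N : LieIdeal F (LieFreeProduct F L₁ L₂)}

theorem lieJ2ToProd_bijective_of_inverse (hN : N.toLieSubalgebra = (inclusion N₁ N₂).range)
    (s : L₁ × L₂ →ₗ⁅F⁆ LieFreeProduct F L₁ L₂) (hs : ∀ x ∈ lieIdealProd N₁ N₂, s x ∈ N)
    (h : ∀ x, s (toProd F L₁ L₂ x) = x) (h' : ∀ x, toProd F L₁ L₂ (s x) = x) :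
    Function.Bijective (lieJ2ToProd hN) :=
  Function.bijective_iff_has_inverse.2 ⟨lieJ2Map s hs,
    fun t => Subtype.ext (map_map_eq_self _ _ (toProd_mem hN) hs h t.1),
    fun t => Subtype.ext (map_map_eq_self _ _ hs (toProd_mem hN) h' t.1)⟩

/-- If `L₁ = 0`, the free product and the direct sum are both `L₂`. -/
theorem lieJ2ToProd_bijective_of_left (hN : N.toLieSubalgebra = (inclusion N₁ N₂).range)
    (h : ∀ x : L₁, x = 0) : Function.Bijective (lieJ2ToProd hN) := by
  let s := (inr F L₁ L₂).comp (LieHom.snd F L₁ L₂)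
  refine lieJ2ToProd_bijective_of_inverse hN s (fun x hx => inr_mem hN hx.2) (fun x => ?_)
    (fun x => ?_)
  · have : s.comp (toProd F L₁ L₂) = LieHom.id := by
      apply hom_ext
      · intro x
        rw [h x]
        simp
      · intro x
        change inr F L₁ L₂ (toProd F L₁ L₂ (inr F L₁ L₂ x)).2 = _
        rw [toProd_inr]
        rfl
    exact LieHom.congr_fun this x
  · change toProd F L₁ L₂ (inr F L₁ L₂ x.2) = x
    rw [toProd_inr]
    exact Prod.ext (h x.1).symm rfl

theorem lieJ2ToProd_bijective_of_right (hN : N.toLieSubalgebra = (inclusion N₁ N₂).range)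
    (h : ∀ x : L₂, x = 0) : Function.Bijective (lieJ2ToProd hN) := by
  let s := (inl F L₁ L₂).comp (LieHom.fst F L₁ L₂)
  refine lieJ2ToProd_bijective_of_inverse hN s (fun x hx => inl_mem hN hx.1) (fun x => ?_)
    (fun x => ?_)
  · have : s.comp (toProd F L₁ L₂) = LieHom.id := by
      apply hom_ext
      · intro x
        change inl F L₁ L₂ (toProd F L₁ L₂ (inl F L₁ L₂ x)).1 = _
        rw [toProd_inl]
        rfl
      · intro x
        rw [h x]
        simp
    exact LieHom.congr_fun this x
  · change toProd F L₁ L₂ (inl F L₁ L₂ x.1) = x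
    rw [toProd_inl]
    exact Prod.ext rfl (h x.2).symm

theorem lieJ2ToProd_bijective_of_trivial (hN : N.toLieSubalgebra = (inclusion N₁ N₂).range)
    (h₁ : ∀ x ∈ N₁, x = 0) (h₂ : ∀ x ∈ N₂, x = 0) : Function.Bijective (lieJ2ToProd hN) := by
  have hzero : inclusion N₁ N₂ = 0 := by
    apply hom_ext
    · intro x
      have hx : x = 0 := Subtype.ext (h₁ x x.2)
      rw [hx, map_zero, map_zero, map_zero]
    · intro x
      have hx : x = 0 := Subtype.ext (h₂ x x.2)
      rw [hx, map_zero, map_zero, map_zero]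
  have hz : ∀ x ∈ N, x = 0 := by
    intro x hx
    change x ∈ N.toLieSubalgebra at hx
    rw [hN, hzero] at hx
    obtain ⟨y, rfl⟩ := hx
    rfl
  have hP : ∀ x ∈ lieIdealProd N₁ N₂, x = 0 := fun x hx => Prod.ext (h₁ _ hx.1) (h₂ _ hx.2)
  exact ⟨fun s t _ => Subtype.ext ((eq_zero_of_trivial hz s.1).trans
      (eq_zero_of_trivial hz t.1).symm),
    fun t => ⟨0, Subtype.ext ((eq_zero_of_trivial hP _).trans (eq_zero_of_trivial hP _).symm)⟩⟩

theorem nonempty_linearEquiv_of_surjective (hN : N.toLieSubalgebra = (inclusion N₁ N₂).range)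
    (h : Function.Surjective (lieJ2ToProd hN)) (h' : Subsingleton (N₁.modLie ⊗[F] N₂.modLie)) :
    Nonempty ((lieJ2 (lieIdealProd N₁ N₂) ⧸ (lieJ2ToProd hN).idealRange) ≃ₗ[F]
      N₁.modLie ⊗[F] N₂.modLie) := by
  have : Subsingleton (lieJ2 (lieIdealProd N₁ N₂) ⧸ (lieJ2ToProd hN).idealRange) := by
    refine subsingleton_of_forall_eq 0 fun y => ?_
    obtain ⟨x, rfl⟩ := LieSubmodule.Quotient.surjective_mk' _ y
    obtain ⟨z, rfl⟩ := h x
    exact (LieSubmodule.Quotient.mk_eq_zero _).2 (LieHom.mem_idealRange _ z)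
  exact ⟨0⟩

end Degenerate

end

theorem mainTheorem5 {F : Type u} [Field F]
    {L₁ : Type v} [LieRing L₁] [LieAlgebra F L₁] [FiniteDimensional F L₁]
    {L₂ : Type w} [LieRing L₂] [LieAlgebra F L₂] [FiniteDimensional F L₂]
    (N₁ : LieIdeal F L₁) (N₂ : LieIdeal F L₂)
    -- `N₁ * N₂` is an ideal `N` of `L₁ * L₂`
    (N : LieIdeal F (LieFreeProduct F L₁ L₂))
    (hN : N.toLieSubalgebra = (LieFreeProduct.inclusion N₁ N₂).range) :
    -- the canonical homomorphism embeds `J₂(L₁ * L₂, N₁ * N₂)` in `J₂(L₁ ⊕ L₂, N₁ ⊕ N₂)`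
    -- as an ideal
    Function.Injective (lieJ2ToProd hN) ∧ (lieJ2ToProd hN).IsIdealMorphism ∧
    -- the quotient is the tensor product, in the nonabelian sense with trivial actions
    Nonempty ((lieJ2 (lieIdealProd N₁ N₂) ⧸ (lieJ2ToProd hN).idealRange) ≃ₗ⁅F⁆
      LieTensor (0 : N₁.modLie →ₗ⁅F⁆ LieDerivation F N₂.modLie N₂.modLie)
        (0 : N₂.modLie →ₗ⁅F⁆ LieDerivation F N₁.modLie N₁.modLie)) ∧
    -- and, as a vector space, the usual one
    Nonempty ((lieJ2 (lieIdealProd N₁ N₂) ⧸ (lieJ2ToProd hN).idealRange) ≃ₗ[F]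
      N₁.modLie ⊗[F] N₂.modLie) := by
  suffices h : Function.Injective (lieJ2ToProd hN) ∧
      Nonempty ((lieJ2 (lieIdealProd N₁ N₂) ⧸ (lieJ2ToProd hN).idealRange) ≃ₗ[F]
        N₁.modLie ⊗[F] N₂.modLie) by
    obtain ⟨hinj, ⟨e⟩⟩ := h
    exact ⟨hinj, lieJ2ToProd_isIdealMorphism hN, nonempty_lieEquiv_of_linearEquiv hN e, ⟨e⟩⟩
  have of_left (h₁ : ∀ x ∈ N₁, x = 0) (h : Function.Bijective (lieJ2ToProd hN)) :=
    have := LieIdeal.modLie_subsingleton h₁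
    And.intro h.1 (nonempty_linearEquiv_of_surjective hN h.2 inferInstance)
  -- a nonzero element of one ideal forces the other ideal to be everything
  by_cases z₁ : ∀ x ∈ N₁, x = 0
  · by_cases z₂ : ∀ x ∈ N₂, x = 0
    · exact of_left z₁ (lieJ2ToProd_bijective_of_trivial hN z₁ z₂)
    · push Not at z₂
      obtain ⟨y, hy, hy0⟩ := z₂
      -- `N₂ ≠ 0` forces `N₁ = L₁`, so `N₁ = 0` means `L₁ = 0`.
      exact of_left z₁ (lieJ2ToProd_bijective_of_left hN fun x =>
        z₁ x (LieFreeProduct.mem_left_of_ne_zero hN hy hy0 x))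
  · push Not at z₁
    obtain ⟨x, hx, hx0⟩ := z₁
    have full₂ := LieFreeProduct.mem_right_of_ne_zero hN hx hx0
    by_cases z₂ : ∀ y ∈ N₂, y = 0
    · have h := lieJ2ToProd_bijective_of_right hN fun y => z₂ y (full₂ y)
      have := LieIdeal.modLie_subsingleton z₂
      exact ⟨h.1, nonempty_linearEquiv_of_surjective hN h.2 inferInstance⟩
    · push Not at z₂
      obtain ⟨y, hy, hy0⟩ := z₂
      exact lieJ2ToProd_of_full hN (LieFreeProduct.mem_left_of_ne_zero hN hy hy0) full₂
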